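/- **Conventions.** "Countable" means at most countable. A totally ordered division ring need not be commutative. For a totally ordered division ring $k$, a *$k$-vector lattice* is a left $k$-vector space $E$ with a translation-invariant lattice order such that $k^+E^+\subseteq E^+$; a *$k,\ell$-homomorphism* is a $k$-linear map that is also a lattice homomorphism. An *Abelian $\ell$-group* is an Abelian group with a translation-invariant lattice order; an *$\ell$-homomorphism* is a group homomorphism that is also a lattice homomorphism. An *$\ell$-ideal* of a $k$-vector lattice (resp., an Abelian $\ell$-group) is an order-convex vector subspace (resp., subgroup) closed under the lattice operations. Write $|x|=x\vee(-x)$. The principal $\ell$-ideal generated by $a$ is $\langle a\rangle=\{x : |x|\le\lambda|a|\text{ for some }\lambda\in k^+\}$ (resp., for some $\lambda\in\mathbb{N}$). The set $\mathrm{Id}_c E$ of all principal $\ell$-ideals of $E$, ordered by inclusion, is a lattice with least element $\langle 0\rangle$, and a homomorphism $f\colon E\to F$ induces the map $\mathrm{Id}_c f\colon \mathrm{Id}_c E\to\mathrm{Id}_c F$, $\langle x\rangle\mapsto\langle f(x)\rangle$, which is a lattice homomorphism. A *$0$-lattice* is a lattice with least element $0$; a *$0$-lattice homomorphism* is a lattice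 homomorphism preserving $0$. A distributive $0$-lattice $L$ is *completely normal* if for all $a,b\in L$ there are $x,y\in L$ with $a\vee b=a\vee y=x\vee b$ and $x\wedge y=0$. A lattice homomorphism $\varphi\colon K\to L$ is *closed* if for all $a,b\in K$ and $x\in L$ with $\varphi(a)\le\varphi(b)\vee x$, there is $u\in K$ with $a\le b\vee u$ and $\varphi(u)\le x$. A homomorphism $f\colon E\to F$ *lifts* $\varphi\colon K\to L$ if there are lattice isomorphisms $\alpha\colon\mathrm{Id}_cE\to K$ and $\beta\colon\mathrm{Id}_cF\to L$ with $\varphi\circ\alpha=\beta\circ\mathrm{Id}_cf$. **Theorem 8.3 (Main Theorem).** Let $k$ be a countable totally ordered division ring and let $L$ be a countable completely normal distributive $0$-lattice. 1. For every countable $k$-vector lattice $E$ and every closed $0$-lattice homomorphism $\varphi\colon\mathrm{Id}_cE\to L$, there are a countable $k$-vector lattice $F$, a $k,\ell$-homomorphism $f\colon E\to F$, and a lattice isomorphism $\iota\colon\mathrm{Id}_cF\to L$ such that $\varphi=\iota\circ\mathrm{Id}_cf$. 2. For every countable Abelian $\ell$-group $G$ and every closed $0$-lattice homomorphism $\varphi\colon\mathrm{Id}_cG\to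 L$, there are a countable Abelian $\ell$-group $H$, an $\ell$-homomorphism $f\colon G\to H$, and a lattice isomorphism $\iota\colon\mathrm{Id}_cH\to L$ such that $\varphi=\iota\circ\mathrm{Id}_cf$. 3. For every $k,\ell$-homomorphism $f$ between (not necessarily countable) $k$-vector lattices, and for every $\ell$-homomorphism $f$ between (not necessarily countable) Abelian $\ell$-groups, $\mathrm{Id}_cf$ is a closed $0$-lattice homomorphism. 4. Let $K$ be a countable completely normal distributive $0$-lattice and let $\varphi\colon K\to L$ be a $0$-lattice homomorphism. Then the following are equivalent: (a) $\varphi$ is closed; (b) $\varphi$ is lifted by some $k,\ell$-homomorphism between $k$-vector lattices; (c) $\varphi$ is lifted by some $k,\ell$-homomorphism between countable $k$-vector lattices. Likewise, (a) is equivalent to each of: (b') $\varphi$ is lifted by some $\ell$-homomorphism between Abelian $\ell$-groups; (c') $\varphi$ is lifted by some $\ell$-homomorphism between countable Abelian $\ell$-groups. -/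

import Mathlib

universe u v w z₁ z₂ z₃

set_option linter.unusedSectionVars false

/-!  Lattice-ordered modules.

An Abelian `ℓ`-group is given by `[AddCommGroup G] [Lattice G] [IsOrderedAddMonoid G]`.
A vector lattice over a totally ordered division ring `k` is given by adding
`[Module k E] [PosSMulMono k E]`.  The two cases are treated together: an Abelian `ℓ`-group is a
lattice-ordered module over the ordered ring `ℤ` in exactly one way, its subgroups are its
`ℤ`-submodules and its additive maps are its `ℤ`-linear maps.  -/

/-- Nonnegative scalars distribute over binary meets.  This is automatic for vector lattices over
totally ordered division rings and for Abelian `ℓ`-groups over `ℤ` (see the two instances below);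
it is only used to treat both cases at once. -/
class PosSMulInf (R : Type*) (E : Type*) [Zero R] [LE R] [SMul R E] [Lattice E] : Prop where
  smul_inf' : ∀ (c : R) (a b : E), 0 ≤ c → c • (a ⊓ b) = c • a ⊓ c • b

instance PosSMulInf.ofDivisionRing (k : Type*) (E : Type*) [DivisionRing k] [LinearOrder k]
    [IsStrictOrderedRing k] [AddCommGroup E] [Lattice E] [Module k E]
    [PosSMulMono k E] : PosSMulInf k E where
  smul_inf' c a b hc := by
    rcases hc.eq_or_lt with rfl | hc
    · simp
    · have hi : (0 : k) ≤ c⁻¹ := by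
        by_contra h
        have h1 := mul_neg_of_pos_of_neg hc (not_le.mp h)
        rw [mul_inv_cancel₀ hc.ne'] at h1
        exact absurd h1 (not_lt.mpr zero_le_one)
      apply le_antisymm
      · exact le_inf (smul_le_smul_of_nonneg_left inf_le_left hc.le)
          (smul_le_smul_of_nonneg_left inf_le_right hc.le)
      · have h2 : c⁻¹ • (c • a ⊓ c • b) ≤ a ⊓ b := by
          apply le_inf
          · calc c⁻¹ • (c • a ⊓ c • b) ≤ c⁻¹ • c • a :=
                  smul_le_smul_of_nonneg_left inf_le_left hi
              _ = a := inv_smul_smul₀ hc.ne' a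
          · calc c⁻¹ • (c • a ⊓ c • b) ≤ c⁻¹ • c • b :=
                  smul_le_smul_of_nonneg_left inf_le_right hi
              _ = b := inv_smul_smul₀ hc.ne' b
        calc c • a ⊓ c • b = c • c⁻¹ • (c • a ⊓ c • b) := (smul_inv_smul₀ hc.ne' _).symm
          _ ≤ c • (a ⊓ b) := smul_le_smul_of_nonneg_left h2 hc.le

section LGroup

variable {G : Type*} [AddCommGroup G] [Lattice G] [IsOrderedAddMonoid G]

theorem nsmul_inf_le_of_nonneg {a r : G} (ha : 0 ≤ a) (hr : 0 ≤ r) (n : ℕ) :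
    (n • a) ⊓ r ≤ n • (a ⊓ r) := by
  induction n with
  | zero => simp
  | succ n ih =>
    rw [succ_nsmul, succ_nsmul]
    have hn : 0 ≤ n • a := nsmul_nonneg ha n
    have h0 : 0 ≤ (n • a) ⊓ r := le_inf hn hr
    have key : (n • a + a) ⊓ r ≤ (n • a) ⊓ r + a ⊓ r := by
      have h1 : (n • a + a) ⊓ r - (n • a) ⊓ r ≤ a ⊓ r := by
        apply le_inf
        · rw [sub_le_iff_le_add, add_inf]
          refine inf_le_inf ?_ ?_
          · exact (add_comm _ _).le
          · exact le_add_of_nonneg_left ha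
        · rw [sub_le_iff_le_add]
          exact inf_le_right.trans (le_add_of_nonneg_right h0)
      exact sub_le_iff_le_add'.mp h1
    exact key.trans (add_le_add_left ih _)

theorem nsmul_inf_distrib (n : ℕ) (a b : G) : n • (a ⊓ b) = n • a ⊓ n • b := by
  apply le_antisymm
  · exact le_inf (nsmul_le_nsmul_right inf_le_left n) (nsmul_le_nsmul_right inf_le_right n)
  · set c := a ⊓ b with hc
    have h0 : (a - c) ⊓ (b - c) = 0 := by
      rw [← inf_sub, ← hc, sub_self]
    have ha : 0 ≤ a - c := sub_nonneg.mpr inf_le_left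
    have hb : 0 ≤ b - c := sub_nonneg.mpr inf_le_right
    have h1 : n • (a - c) ⊓ n • (b - c) ≤ 0 := by
      refine (nsmul_inf_le_of_nonneg ha (nsmul_nonneg hb n) n).trans ?_
      have h2 : (a - c) ⊓ n • (b - c) ≤ 0 := by
        rw [inf_comm]
        refine (nsmul_inf_le_of_nonneg hb ha n).trans ?_
        rw [inf_comm, h0, nsmul_zero]
      exact (nsmul_le_nsmul_right h2 n).trans (by rw [nsmul_zero])
    rw [nsmul_sub, nsmul_sub, ← inf_sub] at h1
    exact sub_nonpos.mp h1

instance PosSMulInf.ofInt : PosSMulInf ℤ G where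
  smul_inf' c a b hc := by
    lift c to ℕ using hc
    simpa using nsmul_inf_distrib c a b

instance posSMulMonoIntOfLGroup : PosSMulMono ℤ G where
  smul_le_smul_of_nonneg_left c hc a b hab := by
    lift c to ℕ using hc
    simpa using nsmul_le_nsmul_right hab c

end LGroup

/-- An `ℓ`-ideal of a lattice-ordered module: an order-convex submodule closed under the lattice
operations. For `R = ℤ` this is a convex `ℓ`-subgroup. -/
@[ext]
structure EllIdeal (R : Type*) (E : Type*) [Ring R] [AddCommGroup E] [Lattice E] [Module R E]
    extends Submodule R E where
  sup_mem' : ∀ {x y : E}, x ∈ carrier → y ∈ carrier → x ⊔ y ∈ carrier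
  inf_mem' : ∀ {x y : E}, x ∈ carrier → y ∈ carrier → x ⊓ y ∈ carrier
  convex' : ∀ {x y z : E}, x ∈ carrier → z ∈ carrier → x ≤ y → y ≤ z → y ∈ carrier

/-- The `ℓ`-ideals are ordered by inclusion. -/
instance EllIdeal.instPartialOrder (R : Type*) (E : Type*) [Ring R] [AddCommGroup E] [Lattice E]
    [Module R E] : PartialOrder (EllIdeal R E) :=
  PartialOrder.lift EllIdeal.toSubmodule (fun I J h => by
    cases I; cases J; cases h; rfl)

/-- Homomorphisms of lattice-ordered modules: linear maps that are lattice homomorphisms.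
For a division ring `R = k` these are the `k,ℓ`-homomorphisms, for `R = ℤ` the `ℓ`-homomorphisms
of Abelian `ℓ`-groups. -/
structure EllHom (R : Type*) (E : Type*) (F : Type*) [Ring R] [AddCommGroup E] [Lattice E]
    [Module R E] [AddCommGroup F] [Lattice F] [Module R F] extends E →ₗ[R] F where
  map_sup' : ∀ x y : E, toFun (x ⊔ y) = toFun x ⊔ toFun y
  map_inf' : ∀ x y : E, toFun (x ⊓ y) = toFun x ⊓ toFun y

section Idc

variable (R : Type*) [Ring R] [LinearOrder R] [IsStrictOrderedRing R]
variable {E : Type*} [AddCommGroup E] [Lattice E] [IsOrderedAddMonoid E] [Module R E]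
  [PosSMulMono R E]

/-- Nonnegative scalars are monotone on nonnegative vectors. -/
theorem smul_le_smul_right_of_le {c d : R} (h : c ≤ d) {x : E} (hx : 0 ≤ x) : c • x ≤ d • x := by
  have h1 : (0 : E) ≤ (d - c) • x := smul_nonneg (sub_nonneg.mpr h) hx
  rw [sub_smul] at h1
  exact sub_nonneg.mp h1

theorem abs_smul_le_smul_abs (c : R) (x : E) : |c • x| ≤ |c| • |x| := by
  have key : ∀ d : R, 0 ≤ d → ∀ y : E, |d • y| ≤ d • |y| := fun d hd y => by
    rw [abs_le']
    refine ⟨smul_le_smul_of_nonneg_left (le_abs_self y) hd, ?_⟩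
    rw [← smul_neg]
    exact smul_le_smul_of_nonneg_left (neg_le_abs y) hd
  rcases le_total 0 c with h | h
  · rw [abs_of_nonneg h]
    exact key c h x
  · rw [abs_of_nonpos h, ← abs_neg, ← neg_smul]
    exact key (-c) (neg_nonneg.mpr h) x

/-- The principal `ℓ`-ideal `⟨a⟩ = {x | ∃ c ≥ 0, |x| ≤ c • |a|}`. -/
def EllIdeal.principal (a : E) : EllIdeal R E where
  carrier := {x | ∃ c : R, 0 ≤ c ∧ |x| ≤ c • |a|}
  zero_mem' := ⟨0, le_rfl, by simp⟩
  add_mem' := by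
    rintro x y ⟨c, hc, hx⟩ ⟨d, hd, hy⟩
    refine ⟨c + d, add_nonneg hc hd, ?_⟩
    rw [add_smul]
    exact (abs_add_le x y).trans (add_le_add hx hy)
  smul_mem' := by
    rintro c x ⟨d, hd, hx⟩
    refine ⟨|c| * d, mul_nonneg (abs_nonneg c) hd, ?_⟩
    rw [mul_smul]
    exact (abs_smul_le_smul_abs R c x).trans (smul_le_smul_of_nonneg_left hx (abs_nonneg c))
  sup_mem' := by
    rintro x y ⟨c, hc, hx⟩ ⟨d, hd, hy⟩
    refine ⟨c + d, add_nonneg hc hd, ?_⟩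
    rw [add_smul]
    refine le_trans ?_ (add_le_add hx hy)
    rw [abs_le']
    refine ⟨sup_le ((le_abs_self x).trans (le_add_of_nonneg_right (abs_nonneg y)))
      ((le_abs_self y).trans (le_add_of_nonneg_left (abs_nonneg x))), ?_⟩
    exact (neg_le_neg le_sup_left).trans
      ((neg_le_abs x).trans (le_add_of_nonneg_right (abs_nonneg y)))
  inf_mem' := by
    rintro x y ⟨c, hc, hx⟩ ⟨d, hd, hy⟩
    refine ⟨c + d, add_nonneg hc hd, ?_⟩
    rw [add_smul]
    refine le_trans ?_ (add_le_add hx hy)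
    rw [abs_le']
    refine ⟨inf_le_left.trans ((le_abs_self x).trans (le_add_of_nonneg_right (abs_nonneg y))), ?_⟩
    rw [neg_inf]
    exact sup_le ((neg_le_abs x).trans (le_add_of_nonneg_right (abs_nonneg y)))
      ((neg_le_abs y).trans (le_add_of_nonneg_left (abs_nonneg x)))
  convex' := by
    rintro x y z ⟨c, hc, hx⟩ ⟨d, hd, hz⟩ hxy hyz
    refine ⟨c + d, add_nonneg hc hd, ?_⟩
    rw [add_smul]
    refine le_trans ?_ (add_le_add hx hz)
    rw [abs_le']
    exact ⟨(hyz.trans (le_abs_self z)).trans (le_add_of_nonneg_left (abs_nonneg x)),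
      ((neg_le_neg hxy).trans (neg_le_abs x)).trans (le_add_of_nonneg_right (abs_nonneg z))⟩

theorem EllIdeal.principal_le_iff {a b : E} :
    EllIdeal.principal R a ≤ EllIdeal.principal R b ↔ ∃ c : R, 0 ≤ c ∧ |a| ≤ c • |b| := by
  constructor
  · intro h
    exact h (show a ∈ (EllIdeal.principal R a).toSubmodule from ⟨1, zero_le_one, by simp⟩)
  · rintro ⟨c, hc, hab⟩ x ⟨d, hd, hx⟩
    refine ⟨d * c, mul_nonneg hd hc, hx.trans ?_⟩
    rw [mul_smul]
    exact smul_le_smul_of_nonneg_left hab hd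

theorem EllIdeal.principal_abs (a : E) :
    EllIdeal.principal R |a| = EllIdeal.principal R a := by
  apply le_antisymm <;> rw [EllIdeal.principal_le_iff] <;>
    exact ⟨1, zero_le_one, by simp⟩

/-- `⟨a⟩` is the least `ℓ`-ideal containing `a`. -/
theorem EllIdeal.principal_le_of_mem {a : E} {I : EllIdeal R E} (ha : a ∈ I.toSubmodule) :
    EllIdeal.principal R a ≤ I := by
  rintro x ⟨c, hc, hx⟩
  have h1 : |a| ∈ I.toSubmodule := I.sup_mem' ha (I.toSubmodule.neg_mem ha)
  have h2 : c • |a| ∈ I.toSubmodule := I.toSubmodule.smul_mem c h1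
  exact I.convex' (I.toSubmodule.neg_mem h2) h2
    (neg_le.mp ((neg_le_abs x).trans hx)) ((le_abs_self x).trans hx)

variable (E) in
/-- `Id_c E`: the set of all principal `ℓ`-ideals of `E`, ordered by inclusion. -/
def Idc : Type _ := {I : EllIdeal R E // ∃ a : E, 0 ≤ a ∧ I = EllIdeal.principal R a}

instance Idc.instPartialOrder : PartialOrder (Idc R E) :=
  inferInstanceAs (PartialOrder {I : EllIdeal R E // ∃ a : E, 0 ≤ a ∧ I = EllIdeal.principal R a})

/-- The element `⟨a⟩` of `Id_c E`. -/
def Idc.mk (a : E) : Idc R E :=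
  ⟨EllIdeal.principal R a, |a|, abs_nonneg a, (EllIdeal.principal_abs R a).symm⟩

variable {R}

theorem Idc.mk_le_mk_iff {a b : E} :
    Idc.mk R a ≤ Idc.mk R b ↔ ∃ c : R, 0 ≤ c ∧ |a| ≤ c • |b| :=
  EllIdeal.principal_le_iff R

/-- A nonnegative generator of a principal `ℓ`-ideal. -/
noncomputable def Idc.gen (I : Idc R E) : E := I.2.choose

theorem Idc.gen_nonneg (I : Idc R E) : 0 ≤ I.gen := I.2.choose_spec.1

theorem Idc.mk_gen (I : Idc R E) : Idc.mk R I.gen = I :=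
  Subtype.ext I.2.choose_spec.2.symm

/-- The zero of `Id_c E` is `⟨0⟩ = {0}`. -/
instance Idc.instOrderBot : OrderBot (Idc R E) where
  bot := Idc.mk R 0
  bot_le I := by
    rw [← I.mk_gen, Idc.mk_le_mk_iff]
    exact ⟨0, le_rfl, by simp⟩

theorem Idc.isLUB_mk_sup {a b : E} (ha : 0 ≤ a) (hb : 0 ≤ b) :
    IsLUB {Idc.mk R a, Idc.mk R b} (Idc.mk R (a ⊔ b)) := by
  have hab : 0 ≤ a ⊔ b := ha.trans le_sup_left
  constructor
  · rintro I (rfl | rfl) <;> rw [Idc.mk_le_mk_iff] <;> refine ⟨1, zero_le_one, ?_⟩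
    · rw [one_smul, abs_of_nonneg ha, abs_of_nonneg hab]
      exact le_sup_left
    · rw [one_smul, abs_of_nonneg hb, abs_of_nonneg hab]
      exact le_sup_right
  · intro I hI
    have h1 : Idc.mk R a ≤ I := hI (by simp)
    have h2 : Idc.mk R b ≤ I := hI (by simp)
    rw [← I.mk_gen, Idc.mk_le_mk_iff, abs_of_nonneg I.gen_nonneg] at h1 h2 ⊢
    obtain ⟨c, hc, h1⟩ := h1
    obtain ⟨d, hd, h2⟩ := h2
    rw [abs_of_nonneg ha] at h1
    rw [abs_of_nonneg hb] at h2
    refine ⟨c ⊔ d, hc.trans le_sup_left, ?_⟩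
    rw [abs_of_nonneg hab]
    exact sup_le (h1.trans (smul_le_smul_right_of_le R le_sup_left I.gen_nonneg))
      (h2.trans (smul_le_smul_right_of_le R le_sup_right I.gen_nonneg))

theorem Idc.isGLB_mk_inf [PosSMulInf R E] {a b : E} (ha : 0 ≤ a) (hb : 0 ≤ b) :
    IsGLB {Idc.mk R a, Idc.mk R b} (Idc.mk R (a ⊓ b)) := by
  have hab : 0 ≤ a ⊓ b := le_inf ha hb
  constructor
  · rintro I (rfl | rfl) <;> rw [Idc.mk_le_mk_iff] <;> refine ⟨1, zero_le_one, ?_⟩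
    · rw [one_smul, abs_of_nonneg ha, abs_of_nonneg hab]
      exact inf_le_left
    · rw [one_smul, abs_of_nonneg hb, abs_of_nonneg hab]
      exact inf_le_right
  · intro I hI
    have h1 : I ≤ Idc.mk R a := hI (by simp)
    have h2 : I ≤ Idc.mk R b := hI (by simp)
    rw [← I.mk_gen, Idc.mk_le_mk_iff] at h1 h2 ⊢
    obtain ⟨c, hc, h1⟩ := h1
    obtain ⟨d, hd, h2⟩ := h2
    rw [abs_of_nonneg ha] at h1
    rw [abs_of_nonneg hb] at h2
    have hcd : 0 ≤ c ⊔ d := hc.trans le_sup_left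
    refine ⟨c ⊔ d, hcd, ?_⟩
    rw [abs_of_nonneg hab, PosSMulInf.smul_inf' _ _ _ hcd]
    exact le_inf (h1.trans (smul_le_smul_right_of_le R le_sup_left ha))
      (h2.trans (smul_le_smul_right_of_le R le_sup_right hb))

/-- `Id_c E` is a lattice under inclusion, with `⟨a⟩ ⊔ ⟨b⟩ = ⟨a ⊔ b⟩` and `⟨a⟩ ⊓ ⟨b⟩ = ⟨a ⊓ b⟩`
for `0 ≤ a`, `0 ≤ b`. -/
noncomputable instance Idc.instLattice [PosSMulInf R E] : Lattice (Idc R E) where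
  sup I J := Idc.mk R (I.gen ⊔ J.gen)
  inf I J := Idc.mk R (I.gen ⊓ J.gen)
  le_sup_left I J := by
    conv_lhs => rw [← I.mk_gen]
    exact (Idc.isLUB_mk_sup I.gen_nonneg J.gen_nonneg).1 (by simp)
  le_sup_right I J := by
    conv_lhs => rw [← J.mk_gen]
    exact (Idc.isLUB_mk_sup I.gen_nonneg J.gen_nonneg).1 (by simp)
  sup_le I J K hI hJ := (Idc.isLUB_mk_sup I.gen_nonneg J.gen_nonneg).2 (by
    rintro M (rfl | rfl)
    · rwa [I.mk_gen]
    · rwa [J.mk_gen])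
  inf_le_left I J := by
    conv_rhs => rw [← I.mk_gen]
    exact (Idc.isGLB_mk_inf I.gen_nonneg J.gen_nonneg).1 (by simp)
  inf_le_right I J := by
    conv_rhs => rw [← J.mk_gen]
    exact (Idc.isGLB_mk_inf I.gen_nonneg J.gen_nonneg).1 (by simp)
  le_inf K I J hI hJ := (Idc.isGLB_mk_inf I.gen_nonneg J.gen_nonneg).2 (by
    rintro M (rfl | rfl)
    · rwa [I.mk_gen]
    · rwa [J.mk_gen])

theorem Idc.mk_sup [PosSMulInf R E] {a b : E} (ha : 0 ≤ a) (hb : 0 ≤ b) :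
    Idc.mk R (a ⊔ b) = Idc.mk R a ⊔ Idc.mk R b :=
  (Idc.isLUB_mk_sup ha hb).unique isLUB_pair

theorem Idc.mk_inf [PosSMulInf R E] {a b : E} (ha : 0 ≤ a) (hb : 0 ≤ b) :
    Idc.mk R (a ⊓ b) = Idc.mk R a ⊓ Idc.mk R b :=
  (Idc.isGLB_mk_inf ha hb).unique isGLB_pair

variable {F : Type*} [AddCommGroup F] [Lattice F] [IsOrderedAddMonoid F] [Module R F]
  [PosSMulMono R F]

theorem EllHom.map_abs (f : EllHom R E F) (x : E) : f.toLinearMap |x| = |f.toLinearMap x| := by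
  have h := f.map_sup' x (-x)
  change f.toLinearMap (x ⊔ -x) = f.toLinearMap x ⊔ f.toLinearMap (-x) at h
  rw [map_neg] at h
  exact h

theorem EllHom.map_le_map (f : EllHom R E F) {x y : E} (h : x ≤ y) :
    f.toLinearMap x ≤ f.toLinearMap y := by
  have h1 : f.toLinearMap (x ⊔ y) = f.toLinearMap x ⊔ f.toLinearMap y := f.map_sup' x y
  rw [sup_eq_right.mpr h] at h1
  rw [h1]
  exact le_sup_left

theorem EllHom.mk_map_le (f : EllHom R E F) {a b : E} (h : Idc.mk R a ≤ Idc.mk R b) :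
    Idc.mk R (f.toLinearMap a) ≤ Idc.mk R (f.toLinearMap b) := by
  rw [Idc.mk_le_mk_iff] at h ⊢
  obtain ⟨c, hc, h⟩ := h
  refine ⟨c, hc, ?_⟩
  rw [← f.map_abs, ← f.map_abs, ← map_smul]
  exact f.map_le_map h

/-- The underlying map of `Id_c f`. -/
noncomputable def Idc.mapFun (f : EllHom R E F) (I : Idc R E) : Idc R F :=
  Idc.mk R (f.toLinearMap I.gen)

/-- `Id_c f` sends `⟨a⟩` to `⟨f a⟩`, for every `a`. -/
theorem Idc.mapFun_mk (f : EllHom R E F) (a : E) :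
    Idc.mapFun f (Idc.mk R a) = Idc.mk R (f.toLinearMap a) :=
  le_antisymm (f.mk_map_le (Idc.mk_gen (Idc.mk R a)).le)
    (f.mk_map_le (Idc.mk_gen (Idc.mk R a)).ge)

theorem EllHom.map_nonneg (f : EllHom R E F) {x : E} (h : 0 ≤ x) : 0 ≤ f.toLinearMap x := by
  simpa using f.map_le_map h

/-- The lattice homomorphism `Id_c f : Id_c E → Id_c F`, `⟨a⟩ ↦ ⟨f a⟩`. -/
noncomputable def Idc.map [PosSMulInf R E] [PosSMulInf R F] (f : EllHom R E F) :
    LatticeHom (Idc R E) (Idc R F) where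
  toFun := Idc.mapFun f
  map_sup' I J := by
    have h : f.toLinearMap (I.gen ⊔ J.gen) = f.toLinearMap I.gen ⊔ f.toLinearMap J.gen :=
      f.map_sup' _ _
    conv_lhs => rw [← I.mk_gen, ← J.mk_gen]
    rw [← Idc.mk_sup I.gen_nonneg J.gen_nonneg, Idc.mapFun_mk, h,
      Idc.mk_sup (f.map_nonneg I.gen_nonneg) (f.map_nonneg J.gen_nonneg)]
    rfl
  map_inf' I J := by
    have h : f.toLinearMap (I.gen ⊓ J.gen) = f.toLinearMap I.gen ⊓ f.toLinearMap J.gen :=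
      f.map_inf' _ _
    conv_lhs => rw [← I.mk_gen, ← J.mk_gen]
    rw [← Idc.mk_inf I.gen_nonneg J.gen_nonneg, Idc.mapFun_mk, h,
      Idc.mk_inf (f.map_nonneg I.gen_nonneg) (f.map_nonneg J.gen_nonneg)]
    rfl

theorem Idc.map_mk [PosSMulInf R E] [PosSMulInf R F] (f : EllHom R E F) (a : E) :
    Idc.map f (Idc.mk R a) = Idc.mk R (f.toLinearMap a) :=
  Idc.mapFun_mk f a

end Idc

/-- In an Abelian `ℓ`-group, `⟨a⟩ = {x | ∃ n : ℕ, |x| ≤ n • |a|}`. -/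
theorem EllIdeal.mem_principal_int {G : Type*} [AddCommGroup G] [Lattice G] [IsOrderedAddMonoid G]
    {a x : G} : x ∈ (EllIdeal.principal ℤ a).toSubmodule ↔ ∃ n : ℕ, |x| ≤ n • |a| := by
  constructor
  · rintro ⟨c, hc, h⟩
    lift c to ℕ using hc
    exact ⟨c, by simpa using h⟩
  · rintro ⟨n, h⟩
    exact ⟨n, Int.natCast_nonneg n, by simpa using h⟩

/-- Complete normality of a lattice with zero. -/
def CompletelyNormal (L : Type*) [Lattice L] [OrderBot L] : Prop :=
  ∀ a b : L, ∃ x y : L, a ⊔ b = a ⊔ y ∧ a ⊔ b = x ⊔ b ∧ x ⊓ y = ⊥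

/-- Closed lattice homomorphisms. -/
def ClosedHom {K L : Type*} [Lattice K] [Lattice L] (φ : LatticeHom K L) : Prop :=
  ∀ (a b : K) (x : L), φ a ≤ φ b ⊔ x → ∃ u : K, a ≤ b ⊔ u ∧ φ u ≤ x

/-- `f` lifts `φ` with respect to the functor `Id_c`: there are lattice isomorphisms
`α : Id_c E ≅ K` and `β : Id_c F ≅ L` with `φ ∘ α = β ∘ Id_c f`. -/
def Lifts {R : Type*} [Ring R] [LinearOrder R] [IsStrictOrderedRing R]
    {E : Type*} [AddCommGroup E] [Lattice E] [IsOrderedAddMonoid E] [Module R E]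
    [PosSMulMono R E] [PosSMulInf R E]
    {F : Type*} [AddCommGroup F] [Lattice F] [IsOrderedAddMonoid F] [Module R F]
    [PosSMulMono R F] [PosSMulInf R F]
    {K L : Type*} [Lattice K] [Lattice L] (f : EllHom R E F) (φ : LatticeHom K L) : Prop :=
  ∃ (α : Idc R E ≃o K) (β : Idc R F ≃o L), ∀ I : Idc R E, φ (α I) = β (Idc.map f I)

/-! Closedness and complete normality become usable once the lattice order of `E` is forgotten. Put
p(a) = φ⟨a⁺⟩ (`posValue`). At each prime filter s of L, the vectors a with p(a) in s are the
positive ones of a total preorder on `E`. Closedness of φ turns into a condition on p alone: p a ≤ p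
b ⊔ x gives a scalar c ≥ 0 with p a ⊓ p (a - c • b) ≤ x (`posValue_closed`). Such a "closed
positivity map" lives on a mere vector space, which is easy to enlarge.

The main step adjoins a vector y ≥ 0 with prescribed truth value of y > 0
(`IsClosedPositivity.exists_extension`). The position of y over V is a cut, given by the truth
values of e < y and y < e. A cut known at finitely many e extends to any further vector; complete
normality makes the two new values disjoint (`PartialCut.exists_extension`). Closedness of p allows
the extension to meet any single closedness requirement (`exists_closed_upper`,
`exists_closed_lower`). By countability a generic cut meets all of them (`exists_isClosedCut`).
Running through an enumeration of L makes p surjective.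

The vector lattice F consists of the families, indexed by the points s, of elements of the totally
ordered quotients of V that are given piecewise by finitely many vectors. The set where such a
family does not vanish is an element of L. Closedness is what turns inclusion of supports into
domination by a scalar multiple (`IsClosedPositivity.support_le_iff`), so Id_c F ≅ L. The linear map
V → F sends disjoint vectors to elements with disjoint supports, hence is a lattice homomorphism
(`exists_ellHom_of_supp`).

Abelian ℓ-groups are reduced to the case k = ℚ through the divisible hull. Conversely, ⟨(a - c •
b)⁺⟩ witnesses closedness of Id_c f. A closed φ : K → L is lifted by realizing K over the zero
module and then factoring φ. -/

/-! Points of a distributive lattice with zero. -/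

/-- A (possibly empty) prime filter of a lattice with zero, seen as a predicate. -/
structure LatPoint (L : Type*) [Lattice L] [OrderBot L] where
  holds : L → Prop
  not_bot : ¬ holds ⊥
  sup_iff : ∀ a b, holds (a ⊔ b) ↔ holds a ∨ holds b
  inf_iff : ∀ a b, holds (a ⊓ b) ↔ holds a ∧ holds b

namespace LatPoint

variable {L : Type*} [DistribLattice L] [OrderBot L]

theorem mono (s : LatPoint L) {a b : L} (h : a ≤ b) (ha : s.holds a) : s.holds b := by
  rw [← sup_eq_right.mpr h, s.sup_iff]
  exact Or.inl ha

/-- The prime ideal theorem separates the filter above `a` from the ideal below `b`. A top is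
adjoined first, since `L` need not have one; the complement of the prime ideal restricts to a point
of `L`. Inequalities in `L` thus become propositional reasoning at a point. -/
theorem le_iff {a b : L} : a ≤ b ↔ ∀ s : LatPoint L, s.holds a → s.holds b := by
  refine ⟨fun h s => s.mono h, fun h => ?_⟩
  by_contra hab
  have hdis : Disjoint ((Order.PFilter.principal (a : WithTop L) : Set (WithTop L)))
      (Order.Ideal.principal (b : WithTop L) : Set (WithTop L)) := by
    rw [Set.disjoint_left]
    intro x hx hx'
    exact hab (WithTop.coe_le_coe.mp (le_trans (show (a : WithTop L) ≤ x from hx)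
      (show x ≤ (b : WithTop L) from hx')))
  obtain ⟨J, hJ, hbJ, haJ⟩ := DistribLattice.prime_ideal_of_disjoint_filter_ideal hdis
  have haJ' : (a : WithTop L) ∉ J :=
    Set.disjoint_left.mp haJ (show (a : WithTop L) ∈ Order.PFilter.principal (a : WithTop L) from
      Order.PFilter.mem_principal.mpr le_rfl)
  have hbJ' : (b : WithTop L) ∈ J := hbJ (Order.Ideal.mem_principal_self)
  refine haJ' (by_contra fun hn => ?_)
  refine h ⟨fun c => (c : WithTop L) ∉ J, fun h => h (by simp), fun c d => ?_, fun c d => ?_⟩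
    haJ' hbJ'
  · rw [WithTop.coe_sup, Order.Ideal.sup_mem_iff, not_and_or]
  · rw [WithTop.coe_inf, ← not_or, not_iff_not]
    exact ⟨fun h => hJ.mem_or_mem h, fun h => h.elim (J.lower inf_le_left) (J.lower inf_le_right)⟩

theorem eq_iff {a b : L} : a = b ↔ ∀ s : LatPoint L, s.holds a ↔ s.holds b :=
  ⟨fun h s => by rw [h], fun h =>
    le_antisymm (le_iff.mpr fun s => (h s).1) (le_iff.mpr fun s => (h s).2)⟩

/-- The factor `A` replaces the possibly missing top element, which an empty meet would require. -/
theorem exists_inf {ι : Type*} (D : Finset ι) (f : ι → L) (A : L) :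
    ∃ z : L, ∀ s : LatPoint L, s.holds z ↔ s.holds A ∧ ∀ i ∈ D, s.holds (f i) := by
  classical
  induction D using Finset.induction_on with
  | empty => exact ⟨A, by simp⟩
  | insert i D _ ih =>
    obtain ⟨z, hz⟩ := ih
    refine ⟨z ⊓ f i, fun s => ?_⟩
    rw [s.inf_iff, hz, Finset.forall_mem_insert]
    tauto

theorem exists_sup {ι : Type*} (D : Finset ι) (f : ι → L) :
    ∃ z : L, ∀ s : LatPoint L, s.holds z ↔ ∃ i ∈ D, s.holds (f i) := by
  classical
  induction D using Finset.induction_on with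
  | empty => exact ⟨⊥, fun s => by simp [s.not_bot]⟩
  | insert i D _ ih =>
    obtain ⟨z, hz⟩ := ih
    refine ⟨z ⊔ f i, fun s => ?_⟩
    rw [s.sup_iff, hz, Finset.exists_mem_insert]
    exact or_comm

end LatPoint

/-! Positivity maps. -/

section Positivity

variable (k : Type*) [DivisionRing k] [LinearOrder k] [IsStrictOrderedRing k]
variable {L : Type*} [DistribLattice L] [OrderBot L]
variable {V : Type*} [AddCommGroup V] [Module k V]

/-- `p v` is the truth value in `L` of `0 < v`, for a total preorder on `V` varying over the
points of `L`. -/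
structure IsPositivity (p : V → L) : Prop where
  zero : p 0 = ⊥
  smul : ∀ (c : k) (x : V), 0 < c → p (c • x) = p x
  disj : ∀ x, p x ⊓ p (-x) = ⊥
  add : ∀ x y, p (x + y) ≤ p x ⊔ p y

/-- `p a ≤ p b ⊔ x` is witnessed by a scalar. -/
def ClosedAt (p : V → L) (a b : V) : Prop :=
  ∀ x : L, p a ≤ p b ⊔ x → ∃ c : k, 0 ≤ c ∧ p a ⊓ p (a - c • b) ≤ x

/-- Positivity maps with the property corresponding to closedness of lattice homomorphisms. -/
structure IsClosedPositivity (p : V → L) : Prop extends IsPositivity k p where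
  closed : ∀ a b, ClosedAt k p a b

end Positivity

namespace IsPositivity

variable {k : Type*} [DivisionRing k] [LinearOrder k] [IsStrictOrderedRing k]
variable {L : Type*} [DistribLattice L] [OrderBot L]
variable {V : Type*} [AddCommGroup V] [Module k V]
variable {p : V → L} (hp : IsPositivity k p) (s : LatPoint L)
include hp

theorem not_zero : ¬ s.holds (p 0) := by
  rw [hp.zero]; exact s.not_bot

theorem smul_iff {c : k} (hc : 0 < c) (x : V) : s.holds (p (c • x)) ↔ s.holds (p x) := by
  rw [hp.smul c x hc]

theorem asymm {x : V} (h : s.holds (p x)) : ¬ s.holds (p (-x)) := fun h' =>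
  s.not_bot (by rw [← hp.disj x, s.inf_iff]; exact ⟨h, h'⟩)

theorem asymm_sub {x y : V} (h : s.holds (p (x - y))) : ¬ s.holds (p (y - x)) := by
  rw [← neg_sub]; exact hp.asymm s h

theorem of_add {x y : V} (h : s.holds (p (x + y))) : s.holds (p x) ∨ s.holds (p y) := by
  rw [← s.sup_iff]; exact s.mono (hp.add x y) h

theorem tri {x z : V} (y : V) (h : s.holds (p (x - z))) :
    s.holds (p (x - y)) ∨ s.holds (p (y - z)) := by
  apply hp.of_add
  rwa [sub_add_sub_cancel]

/-- A sum of a positive vector and a vector that is not negative is positive. -/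
theorem add_pos {x y : V} (h : s.holds (p x)) (h' : ¬ s.holds (p (-y))) : s.holds (p (x + y)) := by
  have := hp.of_add s (x := x + y) (y := -y) (by simpa using h)
  tauto

/-- At a point, `a - c • b` lies on the segment from `a` to `a - d • b`, and the positive vectors
are convex. Hence a scalar witnessing closedness may be enlarged, and finitely many witnesses may be
replaced by one. -/
theorem closedAt_mono {a b : V} {c d : k} (hc : 0 ≤ c) (hcd : c ≤ d) (ha : s.holds (p a))
    (h : s.holds (p (a - d • b))) : s.holds (p (a - c • b)) := by
  by_contra hn
  have h1 : s.holds (p (-b)) := by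
    rcases hcd.eq_or_lt with rfl | hcd
    · exact absurd h hn
    · have h2 : a - d • b = (a - c • b) + (d - c) • (-b) := by
        rw [smul_neg, sub_smul]; abel
      rw [h2] at h
      have := hp.of_add s h
      rw [hp.smul_iff s (sub_pos.mpr hcd)] at this
      tauto
  rcases hc.eq_or_lt with rfl | hc
  · simp only [zero_smul, sub_zero] at hn
    exact hn ha
  · have h2 : a = (a - c • b) + c • b := by abel
    rw [h2] at ha
    have := hp.of_add s ha
    rw [hp.smul_iff s hc] at this
    have h3 := hp.asymm s h1
    rw [neg_neg] at h3
    tauto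

theorem comp {W : Type*} [AddCommGroup W] [Module k W] (g : W →ₗ[k] V) :
    IsPositivity k (fun x => p (g x)) where
  zero := by rw [map_zero, hp.zero]
  smul c x hc := by rw [map_smul, hp.smul c _ hc]
  disj x := by rw [map_neg, hp.disj]
  add x y := by rw [map_add]; exact hp.add _ _

theorem closedAt_smul_left {a b : V} (h : ClosedAt k p a b) {d : k} (hd : 0 < d) :
    ClosedAt k p (d • a) b := by
  intro x hx
  rw [hp.smul d a hd] at hx
  obtain ⟨c, hc, h⟩ := h x hx
  refine ⟨d * c, mul_nonneg hd.le hc, ?_⟩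
  rw [mul_smul, ← smul_sub, hp.smul d _ hd, hp.smul d _ hd]
  exact h

theorem closedAt_smul_right {a b : V} (h : ClosedAt k p a b) {d : k} (hd : 0 < d) :
    ClosedAt k p a (d • b) := by
  intro x hx
  rw [hp.smul d b hd] at hx
  obtain ⟨c, hc, h⟩ := h x hx
  refine ⟨c * d⁻¹, mul_nonneg hc (inv_nonneg.mpr hd.le), ?_⟩
  rwa [← mul_smul, mul_assoc, inv_mul_cancel₀ hd.ne', mul_one]

end IsPositivity

theorem IsClosedPositivity.comp {k : Type*} [DivisionRing k] [LinearOrder k]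
    [IsStrictOrderedRing k] {L : Type*} [DistribLattice L] [OrderBot L]
    {V : Type*} [AddCommGroup V] [Module k V] {p : V → L} (hp : IsClosedPositivity k p)
    {W : Type*} [AddCommGroup W] [Module k W] (g : W →ₗ[k] V) :
    IsClosedPositivity k (fun x => p (g x)) where
  toIsPositivity := hp.toIsPositivity.comp g
  closed a b x hx := by
    obtain ⟨c, hc, h⟩ := hp.closed _ _ x hx
    exact ⟨c, hc, by simpa using h⟩

/-! Partial cuts. -/

/-- Truth values `P e` of `e < y` and `Q e` of `y < e`, for a new element `y` and for finitely
many vectors `e`. -/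
structure PartialCut {L : Type*} [DistribLattice L] [OrderBot L] {V : Type*} [AddCommGroup V]
    (p : V → L) where
  dom : Finset V
  P : V → L
  Q : V → L
  disj : ∀ d ∈ dom, P d ⊓ Q d = ⊥
  P_le : ∀ d ∈ dom, ∀ e ∈ dom, P d ≤ P e ⊔ p (e - d)
  Q_le : ∀ d ∈ dom, ∀ e ∈ dom, Q d ≤ Q e ⊔ p (d - e)
  le_sup : ∀ d ∈ dom, ∀ e ∈ dom, p (e - d) ≤ P d ⊔ Q e

namespace PartialCut

variable {k : Type*} [DivisionRing k] [LinearOrder k] [IsStrictOrderedRing k]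
variable {L : Type*} [DistribLattice L] [OrderBot L]
variable {V : Type*} [AddCommGroup V] [Module k V]
variable {p : V → L}

instance : Preorder (PartialCut p) where
  le σ τ := σ.dom ⊆ τ.dom ∧ ∀ d ∈ σ.dom, τ.P d = σ.P d ∧ τ.Q d = σ.Q d
  le_refl σ := ⟨subset_rfl, fun _ _ => ⟨rfl, rfl⟩⟩
  le_trans σ τ υ h h' := ⟨h.1.trans h'.1, fun d hd =>
    ⟨(h'.2 d (h.1 hd)).1.trans (h.2 d hd).1, (h'.2 d (h.1 hd)).2.trans (h.2 d hd).2⟩⟩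

/-- The cut of `-y`. -/
def reflect (σ : PartialCut p) : PartialCut p where
  dom := σ.dom.map (Equiv.neg V).toEmbedding
  P d := σ.Q (-d)
  Q d := σ.P (-d)
  disj d hd := by
    rw [inf_comm]; exact σ.disj _ (by simpa [Finset.mem_map_equiv] using hd)
  P_le d hd e he := by
    have := σ.Q_le (-d) (by simpa [Finset.mem_map_equiv] using hd) (-e)
      (by simpa [Finset.mem_map_equiv] using he)
    rwa [neg_sub_neg] at this
  Q_le d hd e he := by
    have := σ.P_le (-d) (by simpa [Finset.mem_map_equiv] using hd) (-e)
      (by simpa [Finset.mem_map_equiv] using he)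
    rwa [neg_sub_neg] at this
  le_sup d hd e he := by
    have := σ.le_sup (-e) (by simpa [Finset.mem_map_equiv] using he) (-d)
      (by simpa [Finset.mem_map_equiv] using hd)
    rwa [neg_sub_neg, sup_comm] at this

theorem mem_reflect {σ : PartialCut p} {d : V} : d ∈ σ.reflect.dom ↔ -d ∈ σ.dom := by
  simp [reflect, Finset.mem_map_equiv]

theorem le_reflect {σ τ : PartialCut p} (h : σ.reflect ≤ τ) : σ ≤ τ.reflect := by
  refine ⟨fun d hd => ?_, fun d hd => ?_⟩
  · rw [mem_reflect]
    exact h.1 (by rwa [mem_reflect, neg_neg])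
  · have := h.2 (-d) (by rwa [mem_reflect, neg_neg])
    simp only [reflect, neg_neg] at this
    exact ⟨this.2, this.1⟩

/-- The conditions on `P e` are upper bounds and lower bounds, and the hypothesis on `A` says that
`A` respects the lower ones. The largest candidates `P₁` and `Q₁` meet all bounds but may overlap;
complete normality shrinks them to disjoint elements, losing only points common to both. At a common
point every `i` satisfies (`i < y` or `e < i`) and (`y < i` or `i < e`), so there the lower bounds
hold without help from `P e` or `Q e`. -/
theorem exists_extension (hL : CompletelyNormal L) (hp : IsPositivity k p) (σ : PartialCut p)
    (e : V) (A : L) (hA : ∀ i ∈ σ.dom, σ.P i ≤ A ⊔ p (e - i) ∧ p (i - e) ≤ A ⊔ σ.Q i) :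
    ∃ τ : PartialCut p, σ ≤ τ ∧ e ∈ τ.dom ∧ τ.P e ≤ A := by
  classical
  by_cases he : e ∈ σ.dom
  · refine ⟨σ, le_rfl, he, (hA e he).1.trans ?_⟩
    rw [sub_self, hp.zero, sup_bot_eq]
  obtain ⟨P₁, hP₁⟩ := LatPoint.exists_inf σ.dom (fun i => σ.P i ⊔ p (i - e)) A
  -- `B` lies above every lower bound for `Q e`, so it imposes no real restriction on `Q₁`; it only
  -- stands in for a top.
  obtain ⟨B, hB⟩ := LatPoint.exists_sup σ.dom (fun i => σ.Q i ⊔ p (e - i))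
  obtain ⟨Q₁, hQ₁⟩ := LatPoint.exists_inf σ.dom (fun i => σ.Q i ⊔ p (e - i)) B
  obtain ⟨x, y, hx, hy, hxy⟩ := hL P₁ Q₁
  simp only [LatPoint.sup_iff] at hP₁ hB hQ₁
  -- `P₁ ⊓ x` and `Q₁ ⊓ y` are disjoint and have join `P₁ ⊔ Q₁`
  have hdisj : ∀ s : LatPoint L, ¬ (s.holds (P₁ ⊓ x) ∧ s.holds (Q₁ ⊓ y)) := fun s h => by
    simp only [s.inf_iff] at h
    exact s.not_bot (hxy ▸ (s.inf_iff x y).mpr ⟨h.1.2, h.2.2⟩)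
  have hcov : ∀ s : LatPoint L, (s.holds P₁ → s.holds (P₁ ⊓ x) ∨ s.holds Q₁) ∧
      (s.holds Q₁ → s.holds (Q₁ ⊓ y) ∨ s.holds P₁) := fun s => by
    have h1 : s.holds (P₁ ⊔ Q₁) ↔ s.holds (P₁ ⊔ y) := by rw [hx]
    have h2 : s.holds (P₁ ⊔ Q₁) ↔ s.holds (x ⊔ Q₁) := by rw [hy]
    simp only [s.sup_iff, s.inf_iff] at *
    tauto
  have hPle : ∀ s : LatPoint L, s.holds (P₁ ⊓ x) → s.holds P₁ := fun s h => ((s.inf_iff _ _).1 h).1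
  have hQle : ∀ s : LatPoint L, s.holds (Q₁ ⊓ y) → s.holds Q₁ := fun s h => ((s.inf_iff _ _).1 h).1
  clear hx hy hxy
  generalize P₁ ⊓ x = P₂ at *
  generalize Q₁ ⊓ y = Q₂ at *
  -- In each of the four lower bounds, maximality puts the point in one of `P₁`, `Q₁`; a failure
  -- puts it in the other as well, and disjointness of the old cut or asymmetry of `p` then gives
  -- the contradiction.
  have hPlow : ∀ s : LatPoint L, ∀ i ∈ σ.dom, s.holds (σ.P i) →
      s.holds P₂ ∨ s.holds (p (e - i)) := by
    intro s i hi h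
    by_contra! hn
    have h1 : s.holds P₁ := by
      refine (hP₁ s).mpr ⟨?_, fun j hj => ?_⟩
      · have := s.mono (hA i hi).1 h
        rw [s.sup_iff] at this; tauto
      · have := s.mono (σ.P_le i hi j hj) h
        rw [s.sup_iff] at this
        have h2 := hp.tri s (x := j) (z := i) e
        tauto
    have h2 : s.holds Q₁ := by have := hcov s; tauto
    have h3 := ((hQ₁ s).mp h2).2 i hi
    have h4 : ¬ (s.holds (σ.P i) ∧ s.holds (σ.Q i)) := by
      rw [← s.inf_iff, σ.disj i hi]; exact s.not_bot
    tauto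
  have hQlow : ∀ s : LatPoint L, ∀ i ∈ σ.dom, s.holds (σ.Q i) →
      s.holds Q₂ ∨ s.holds (p (i - e)) := by
    intro s i hi h
    by_contra! hn
    have h1 : s.holds Q₁ := by
      have : ∀ j ∈ σ.dom, s.holds (σ.Q j) ∨ s.holds (p (e - j)) := fun j hj => by
        have := s.mono (σ.Q_le i hi j hj) h
        rw [s.sup_iff] at this
        have h2 := hp.tri s (x := i) (z := j) e
        tauto
      exact (hQ₁ s).mpr ⟨(hB s).mpr ⟨i, hi, this i hi⟩, this⟩
    have h2 : s.holds P₁ := by have := hcov s; tauto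
    have h3 := ((hP₁ s).mp h2).2 i hi
    have h4 : ¬ (s.holds (σ.P i) ∧ s.holds (σ.Q i)) := by
      rw [← s.inf_iff, σ.disj i hi]; exact s.not_bot
    tauto
  have hPsup : ∀ s : LatPoint L, ∀ i ∈ σ.dom, s.holds (p (i - e)) →
      s.holds P₂ ∨ s.holds (σ.Q i) := by
    intro s i hi h
    by_contra! hn
    have h1 : s.holds P₁ := by
      refine (hP₁ s).mpr ⟨?_, fun j hj => ?_⟩
      · have := s.mono (hA i hi).2 h
        rw [s.sup_iff] at this; tauto
      · have h2 := hp.tri s j h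
        have := s.mono (σ.le_sup j hj i hi)
        rw [s.sup_iff] at this
        tauto
    have h2 : s.holds Q₁ := by have := hcov s; tauto
    have h3 := ((hQ₁ s).mp h2).2 i hi
    have h4 := hp.asymm_sub s h
    tauto
  have hQsup : ∀ s : LatPoint L, ∀ i ∈ σ.dom, s.holds (p (e - i)) →
      s.holds (σ.P i) ∨ s.holds Q₂ := by
    intro s i hi h
    by_contra! hn
    have h1 : s.holds Q₁ := by
      have : ∀ j ∈ σ.dom, s.holds (σ.Q j) ∨ s.holds (p (e - j)) := fun j hj => by
        have h2 := hp.tri s j h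
        have := s.mono (σ.le_sup i hi j hj)
        rw [s.sup_iff] at this
        tauto
      exact (hQ₁ s).mpr ⟨(hB s).mpr ⟨i, hi, this i hi⟩, this⟩
    have h2 : s.holds P₁ := by have := hcov s; tauto
    have h3 := ((hP₁ s).mp h2).2 i hi
    have h4 := hp.asymm_sub s h
    tauto
  have hne : ∀ d ∈ σ.dom, d ≠ e := fun d hd h => he (h ▸ hd)
  refine ⟨⟨insert e σ.dom, Function.update σ.P e P₂, Function.update σ.Q e Q₂, ?_, ?_, ?_, ?_⟩,
    ⟨Finset.subset_insert _ _, fun d hd => ?_⟩, Finset.mem_insert_self _ _, ?_⟩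
  · rw [Finset.forall_mem_insert]
    refine ⟨?_, fun d hd => ?_⟩
    · simp only [Function.update_self]
      rw [LatPoint.eq_iff]
      intro s
      have := hdisj s
      have := s.not_bot
      rw [s.inf_iff]; tauto
    · simp only [Function.update_of_ne (hne d hd)]
      exact σ.disj d hd
  · simp only [Finset.forall_mem_insert, Function.update_self, sub_self]
    refine ⟨⟨le_sup_left, fun d hd => ?_⟩, fun d hd => ⟨?_, fun j hj => ?_⟩⟩
    · rw [Function.update_of_ne (hne d hd), LatPoint.le_iff]
      intro s h
      rw [s.sup_iff]; exact ((hP₁ s).mp (hPle s h)).2 d hd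
    · rw [Function.update_of_ne (hne d hd), LatPoint.le_iff]
      intro s h
      rw [s.sup_iff]; exact hPlow s d hd h
    · rw [Function.update_of_ne (hne d hd), Function.update_of_ne (hne j hj)]
      exact σ.P_le d hd j hj
  · simp only [Finset.forall_mem_insert, Function.update_self, sub_self]
    refine ⟨⟨le_sup_left, fun d hd => ?_⟩, fun d hd => ⟨?_, fun j hj => ?_⟩⟩
    · rw [Function.update_of_ne (hne d hd), LatPoint.le_iff]
      intro s h
      rw [s.sup_iff]; exact ((hQ₁ s).mp (hQle s h)).2 d hd
    · rw [Function.update_of_ne (hne d hd), LatPoint.le_iff]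
      intro s h
      rw [s.sup_iff]; exact hQlow s d hd h
    · rw [Function.update_of_ne (hne d hd), Function.update_of_ne (hne j hj)]
      exact σ.Q_le d hd j hj
  · simp only [Finset.forall_mem_insert, Function.update_self, sub_self, hp.zero]
    refine ⟨⟨bot_le, fun d hd => ?_⟩, fun d hd => ⟨?_, fun j hj => ?_⟩⟩
    · rw [Function.update_of_ne (hne d hd), LatPoint.le_iff]
      intro s h
      rw [s.sup_iff]; exact hPsup s d hd h
    · rw [Function.update_of_ne (hne d hd), LatPoint.le_iff]
      intro s h
      rw [s.sup_iff]; exact hQsup s d hd h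
    · rw [Function.update_of_ne (hne d hd), Function.update_of_ne (hne j hj)]
      exact σ.le_sup d hd j hj
  · simp only [Function.update_of_ne (hne d hd), and_self]
  · simp only [Function.update_self]
    rw [LatPoint.le_iff]
    exact fun s h => ((hP₁ s).mp (hPle s h)).1

end PartialCut

namespace PartialCut

variable {k : Type*} [DivisionRing k] [LinearOrder k] [IsStrictOrderedRing k]
variable {L : Type*} [DistribLattice L] [OrderBot L]
variable {V : Type*} [AddCommGroup V] [Module k V]
variable {p : V → L}

theorem exists_extension_Q (hL : CompletelyNormal L) (hp : IsPositivity k p) (σ : PartialCut p)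
    (e : V) (B : L) (hB : ∀ i ∈ σ.dom, σ.Q i ≤ B ⊔ p (i - e) ∧ p (e - i) ≤ B ⊔ σ.P i) :
    ∃ τ : PartialCut p, σ ≤ τ ∧ e ∈ τ.dom ∧ τ.Q e ≤ B := by
  obtain ⟨τ, hτ, he, h⟩ := exists_extension hL hp σ.reflect (-e) B (fun i hi => by
    have := hB (-i) (mem_reflect.mp hi)
    rw [show -e - i = -i - e by abel, show i - -e = e - -i by abel]
    exact this)
  exact ⟨τ.reflect, le_reflect hτ, mem_reflect.mpr he, h⟩

theorem exists_mem_dom (hL : CompletelyNormal L) (hp : IsPositivity k p) (σ : PartialCut p)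
    (e : V) : ∃ τ : PartialCut p, σ ≤ τ ∧ e ∈ τ.dom := by
  -- The join of all terms that `A` has to dominate is admissible.
  obtain ⟨A, hA⟩ := LatPoint.exists_sup σ.dom (fun i => σ.P i ⊔ p (i - e))
  simp only [LatPoint.sup_iff] at hA
  obtain ⟨τ, h, he, -⟩ := exists_extension hL hp σ e A fun i hi => by
    simp only [LatPoint.le_iff, LatPoint.sup_iff, hA]
    exact ⟨fun s h => Or.inl ⟨i, hi, Or.inl h⟩, fun s h => Or.inl ⟨i, hi, Or.inr h⟩⟩
  exact ⟨τ, h, he⟩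

/-- The bound is strict so that `d - c` can be cancelled as a positive scalar. -/
theorem exists_uniform_scalar {D : Finset V} {f : V → k → Prop} (h : ∀ i ∈ D, ∃ c, 0 ≤ c ∧ f i c) :
    ∃ d : k, 0 < d ∧ ∀ i ∈ D, ∃ c, 0 ≤ c ∧ c < d ∧ f i c := by
  classical
  induction D using Finset.induction_on with
  | empty => exact ⟨1, one_pos, by simp⟩
  | insert i D _ ih =>
    rw [Finset.forall_mem_insert] at h
    obtain ⟨d, hd, hD⟩ := ih h.2
    obtain ⟨c, hc, hi⟩ := h.1
    refine ⟨max d (c + 1), lt_max_of_lt_left hd, ?_⟩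
    rw [Finset.forall_mem_insert]
    refine ⟨⟨c, hc, lt_max_of_lt_right (lt_add_one c), hi⟩, fun j hj => ?_⟩
    obtain ⟨c, hc, hcd, hj⟩ := hD j hj
    exact ⟨c, hc, lt_max_of_lt_left hcd, hj⟩

/-- A cut can be extended in such a way that it is closed at `y - e` and `b`. -/
theorem exists_closed_upper (hL : CompletelyNormal L) (hp : IsClosedPositivity k p)
    (σ : PartialCut p) {e b : V} {x : L} (he : e ∈ σ.dom) (hx : σ.P e ≤ p b ⊔ x) :
    ∃ τ : PartialCut p, σ ≤ τ ∧ ∃ c : k, 0 ≤ c ∧ e + c • b ∈ τ.dom ∧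
      τ.P e ⊓ τ.P (e + c • b) ≤ x := by
  -- Closedness of `p` applies because p (i - e) ≤ P e ⊔ Q i ≤ p b ⊔ x ⊔ Q i: the known vectors `i`
  -- above `y` approximate `y - e`.
  have h1 : ∀ i ∈ σ.dom, ∃ c : k, 0 ≤ c ∧ p (i - e) ⊓ p ((i - e) - c • b) ≤ x ⊔ σ.Q i :=
    fun i hi => hp.closed (i - e) b _ <| by
      refine (σ.le_sup e he i hi).trans ((sup_le_sup_right hx _).trans ?_)
      rw [sup_assoc]
  obtain ⟨d, hd, h2⟩ := exists_uniform_scalar h1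
  have h3 : ∀ s : LatPoint L, ∀ i ∈ σ.dom, s.holds (p (i - e)) →
      s.holds (p ((i - e) - d • b)) → s.holds x ∨ s.holds (σ.Q i) := by
    intro s i hi h h'
    obtain ⟨c, hc, hcd, hi⟩ := h2 i hi
    rw [← s.sup_iff]
    refine s.mono hi ?_
    rw [s.inf_iff]
    exact ⟨h, hp.closedAt_mono s hc hcd.le h h'⟩
  -- The bound `x ⊔ p (-b)` suffices: at a point of `P e` outside `x`, `hx` forces `b` to be
  -- positive, which excludes `p (-b)`.
  obtain ⟨τ, hτ, hmem, hP⟩ := exists_extension hL hp.toIsPositivity σ (e + d • b) (x ⊔ p (-b)) (by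
    intro i hi
    simp only [LatPoint.le_iff, LatPoint.sup_iff]
    constructor
    · intro s h
      by_contra! hn
      have h4 := s.mono (σ.P_le i hi e he) h
      rw [s.sup_iff] at h4
      have h5 : s.holds (p (e - i)) → s.holds (p (e - (e + d • b))) ∨ s.holds (p (e + d • b - i)) :=
        hp.tri s _
      rw [show e - (e + d • b) = d • (-b) by rw [smul_neg]; abel, hp.smul_iff s hd] at h5
      have h6 : s.holds (p b) := by
        have := s.mono hx (by tauto)
        rw [s.sup_iff] at this; tauto
      obtain ⟨c, hc, hcd, h7⟩ := h2 i hi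
      have h8 : s.holds (p (i - e)) := by
        have := hp.of_add s (x := e + d • b - i) (y := i - e) (by
          rw [show e + d • b - i + (i - e) = d • b by abel, hp.smul_iff s hd]; exact h6)
        tauto
      have h9 : s.holds (p (i - e - c • b)) := by
        have := hp.of_add s (x := e + d • b - i) (y := i - e - c • b) (by
          rw [show e + d • b - i + (i - e - c • b) = (d - c) • b by rw [sub_smul]; abel,
            hp.smul_iff s (sub_pos.mpr hcd)]; exact h6)
        tauto
      have h10 := s.mono h7 ((s.inf_iff _ _).mpr ⟨h8, h9⟩)
      rw [s.sup_iff] at h10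
      have h11 : ¬ (s.holds (σ.P i) ∧ s.holds (σ.Q i)) := by
        rw [← s.inf_iff, σ.disj i hi]; exact s.not_bot
      tauto
    · intro s h
      have h4 := hp.tri s e h
      rw [show e - (e + d • b) = d • (-b) by rw [smul_neg]; abel, hp.smul_iff s hd] at h4
      have h5 := h3 s i hi
      rw [← sub_sub] at h
      tauto)
  refine ⟨τ, hτ, d, hd.le, hmem, ?_⟩
  rw [(hτ.2 e he).1, LatPoint.le_iff]
  intro s h
  rw [s.inf_iff] at h
  have h4 := s.mono hP h.2
  have h5 := s.mono hx h.1
  rw [s.sup_iff] at h4 h5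
  have h6 : s.holds (p b) → ¬ s.holds (p (-b)) := hp.asymm s
  tauto

/-- A cut can be extended in such a way that it is closed at `a` and `y - e`. -/
theorem exists_closed_lower (hL : CompletelyNormal L) (hp : IsClosedPositivity k p)
    (σ : PartialCut p) {e a : V} {x : L} (he : e ∈ σ.dom) (hx : p a ≤ σ.P e ⊔ x) :
    ∃ τ : PartialCut p, σ ≤ τ ∧ ∃ c : k, 0 < c ∧ e + c • a ∈ τ.dom ∧
      p a ⊓ τ.Q (e + c • a) ≤ x := by
  -- Here p a ≤ P e ⊔ x ≤ P i ⊔ p (i - e) ⊔ x, so closedness of `p` applies to `a` and `i - e`.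
  have h1 : ∀ i ∈ σ.dom, ∃ c : k, 0 ≤ c ∧ p a ⊓ p (a - c • (i - e)) ≤ x ⊔ σ.P i :=
    fun i hi => hp.closed a (i - e) _ <| by
      refine hx.trans ((sup_le_sup_right (σ.P_le e he i hi) _).trans ?_)
      rw [sup_comm (σ.P i), sup_assoc, sup_comm x]
  obtain ⟨d, hd, h2⟩ := exists_uniform_scalar h1
  have hi : 0 < d⁻¹ := inv_pos.mpr hd
  have h3 : ∀ s : LatPoint L, ∀ i ∈ σ.dom, s.holds (p a) → s.holds (p (i - e)) →
      ¬ s.holds (p (i - (e + d⁻¹ • a))) → s.holds x ∨ s.holds (σ.P i) := by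
    intro s i hi h h' hn
    obtain ⟨c, hc, hcd, hi⟩ := h2 i hi
    rw [← s.sup_iff]
    refine s.mono hi ?_
    rw [s.inf_iff]
    refine ⟨h, ?_⟩
    -- If `i` is not above `e + d⁻¹ • a`, this writes `a - c • (i - e)` as a positive vector plus
    -- one that is not negative.
    have h4 : a - c • (i - e) = (d - c) • (i - e) + d • (e + d⁻¹ • a - i) := by
      rw [sub_smul, smul_sub d (e + d⁻¹ • a) i, smul_add, smul_inv_smul₀ hd.ne', smul_sub d i e]
      abel
    rw [h4]
    apply hp.add_pos s
    · rwa [hp.smul_iff s (sub_pos.mpr hcd)]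
    · rwa [← smul_neg, neg_sub, hp.smul_iff s hd]
  -- The bound `x ⊔ σ.Q e` suffices: `p a` lies below `σ.P e ⊔ x`, and `σ.P e` is disjoint from `σ.Q
  -- e`.
  obtain ⟨τ, hτ, hmem, hQ⟩ := exists_extension_Q hL hp.toIsPositivity σ (e + d⁻¹ • a) (x ⊔ σ.Q e) (by
    intro i hi'
    simp only [LatPoint.le_iff, LatPoint.sup_iff]
    constructor
    · intro s h
      by_contra! hn
      have h4 := s.mono (σ.Q_le i hi' e he) h
      rw [s.sup_iff] at h4
      have h5 : s.holds (p (i - e)) → _ := hp.tri s (e + d⁻¹ • a)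
      rw [add_sub_cancel_left, hp.smul_iff s hi] at h5
      have h6 := h3 s i hi'
      have h11 : ¬ (s.holds (σ.P i) ∧ s.holds (σ.Q i)) := by
        rw [← s.inf_iff, σ.disj i hi']; exact s.not_bot
      tauto
    · intro s h
      by_contra! hn
      have h4 := hp.tri s e h
      rw [add_sub_cancel_left, hp.smul_iff s hi] at h4
      have h5 := s.mono (σ.le_sup i hi' e he)
      have h6 := s.mono hx
      have h7 := s.mono (σ.P_le e he i hi')
      rw [s.sup_iff] at h5 h6 h7
      have h8 := h3 s i hi'
      have h9 := hp.asymm_sub s h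
      tauto)
  refine ⟨τ, hτ, d⁻¹, hi, hmem, ?_⟩
  rw [LatPoint.le_iff]
  intro s h
  rw [s.inf_iff] at h
  have h4 := s.mono hQ h.2
  have h5 := s.mono hx h.1
  rw [s.sup_iff] at h4 h5
  have h11 : ¬ (s.holds (σ.P e) ∧ s.holds (σ.Q e)) := by
    rw [← s.inf_iff, σ.disj e he]; exact s.not_bot
  tauto

end PartialCut

/-! ### Generic closed cuts -/

/-- Truth values `P e` of `e < y` and `Q e` of `y < e`, for a new element `y` and for all `e`,
such that the extension to the space spanned by `y` is again closed. -/
structure IsClosedCut (k : Type*) [DivisionRing k] [LinearOrder k]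
    {L : Type*} [DistribLattice L] [OrderBot L] {V : Type*} [AddCommGroup V] [Module k V]
    (p : V → L) (P Q : V → L) : Prop where
  disj : ∀ d, P d ⊓ Q d = ⊥
  P_le : ∀ d e, P d ≤ P e ⊔ p (e - d)
  Q_le : ∀ d e, Q d ≤ Q e ⊔ p (d - e)
  le_sup : ∀ d e, p (e - d) ≤ P d ⊔ Q e
  P_upper : ∀ e b x, P e ≤ p b ⊔ x → ∃ c : k, 0 ≤ c ∧ P e ⊓ P (e + c • b) ≤ x
  Q_upper : ∀ e b x, Q e ≤ p b ⊔ x → ∃ c : k, 0 ≤ c ∧ Q e ⊓ Q (e - c • b) ≤ x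
  P_lower : ∀ e a x, p a ≤ P e ⊔ x → ∃ c : k, 0 < c ∧ p a ⊓ Q (e + c • a) ≤ x
  Q_lower : ∀ e a x, p a ≤ Q e ⊔ x → ∃ c : k, 0 < c ∧ p a ⊓ P (e - c • a) ≤ x

section GenericCut

variable {k : Type*} [DivisionRing k] [LinearOrder k] [IsStrictOrderedRing k]
variable {L : Type*} [DistribLattice L] [OrderBot L]
variable {V : Type*} [AddCommGroup V] [Module k V]
variable {p : V → L}

variable (k) in
/-- The partial cuts that meet the requirement for closedness at `e`, `b` and `x`. -/
def PartialCut.Good (σ : PartialCut p) (e b : V) (x : L) : Prop :=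
  e ∈ σ.dom ∧
  (σ.P e ≤ p b ⊔ x → ∃ c : k, 0 ≤ c ∧ e + c • b ∈ σ.dom ∧ σ.P e ⊓ σ.P (e + c • b) ≤ x) ∧
  (p b ≤ σ.P e ⊔ x → ∃ c : k, 0 < c ∧ e + c • b ∈ σ.dom ∧ p b ⊓ σ.Q (e + c • b) ≤ x)

/-- This is the density needed for the generic construction. Values never change under extension, so
once `e` is in the domain it is settled whether each requirement has a true premise, and the
requirements can be met in turn. -/
theorem PartialCut.exists_good (hL : CompletelyNormal L) (hp : IsClosedPositivity k p)
    (σ : PartialCut p) (e b : V) (x : L) : ∃ τ, σ ≤ τ ∧ τ.Good k e b x := by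
  obtain ⟨σ₁, h₁, he⟩ := σ.exists_mem_dom hL hp.toIsPositivity e
  have h2 : ∃ σ₂, σ₁ ≤ σ₂ ∧ (σ₁.P e ≤ p b ⊔ x → ∃ c : k, 0 ≤ c ∧ e + c • b ∈ σ₂.dom ∧
      σ₂.P e ⊓ σ₂.P (e + c • b) ≤ x) := by
    by_cases h : σ₁.P e ≤ p b ⊔ x
    · obtain ⟨τ, hτ, h⟩ := σ₁.exists_closed_upper hL hp he h
      exact ⟨τ, hτ, fun _ => h⟩
    · exact ⟨σ₁, le_rfl, fun h' => absurd h' h⟩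
  obtain ⟨σ₂, h₂, hu⟩ := h2
  have he₂ := h₂.1 he
  have h3 : ∃ σ₃, σ₂ ≤ σ₃ ∧ (p b ≤ σ₂.P e ⊔ x → ∃ c : k, 0 < c ∧ e + c • b ∈ σ₃.dom ∧
      p b ⊓ σ₃.Q (e + c • b) ≤ x) := by
    by_cases h : p b ≤ σ₂.P e ⊔ x
    · obtain ⟨τ, hτ, h⟩ := σ₂.exists_closed_lower hL hp he₂ h
      exact ⟨τ, hτ, fun _ => h⟩
    · exact ⟨σ₂, le_rfl, fun h' => absurd h' h⟩
  obtain ⟨σ₃, h₃, hl⟩ := h3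
  refine ⟨σ₃, h₁.trans (h₂.trans h₃), h₃.1 he₂, fun h => ?_, fun h => ?_⟩
  · rw [(h₃.2 e he₂).1, (h₂.2 e he).1] at h
    obtain ⟨c, hc, hm, h⟩ := hu h
    refine ⟨c, hc, h₃.1 hm, ?_⟩
    rwa [(h₃.2 _ hm).1, (h₃.2 e he₂).1]
  · rw [(h₃.2 e he₂).1] at h
    exact hl h

/-- Rasiowa–Sikorski: there are countably many requirements `(e, b, x)`, each met on a cofinal set
of partial cuts, so an ideal through the initial cut at `0` meets them all. Its members agree where
they overlap, and their union is the cut sought. -/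
theorem exists_isClosedCut [Countable V] [Countable L] (hL : CompletelyNormal L)
    (hp : IsClosedPositivity k p) (c : L) :
    ∃ P Q : V → L, IsClosedCut k p P Q ∧ P 0 = c ∧ Q 0 = ⊥ := by
  classical
  let σ₀ : PartialCut p := ⟨{0}, fun _ => c, fun _ => ⊥, by simp, by simp, by simp,
    by simp [hp.zero]⟩
  have : Encodable (V × V × L) := Encodable.ofCountable _
  let 𝒟 : (V × V × L) ⊕ (V × V × L) → Order.Cofinal (PartialCut p) := Sum.elim
    (fun t => ⟨{τ | τ.Good k t.1 t.2.1 t.2.2}, fun σ => by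
      obtain ⟨τ, h, h'⟩ := σ.exists_good hL hp t.1 t.2.1 t.2.2
      exact ⟨τ, h', h⟩⟩)
    -- The requirements on `Q` are those on `P` for the reflected cut.
    (fun t => ⟨{τ | τ.reflect.Good k t.1 t.2.1 t.2.2}, fun σ => by
      obtain ⟨τ, h, h'⟩ := σ.reflect.exists_good hL hp t.1 t.2.1 t.2.2
      refine ⟨τ.reflect, ?_, PartialCut.le_reflect h⟩
      have : τ.reflect.reflect = τ := by
        cases τ; simp [PartialCut.reflect]; ext; simp
      exact (congrArg (fun τ => PartialCut.Good k τ t.1 t.2.1 t.2.2) this).mpr h'⟩)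
  let I := Order.idealOfCofinals σ₀ 𝒟
  have h1 : ∀ e b x, ∃ τ ∈ I, τ.Good k e b x := fun e b x => by
    obtain ⟨τ, h, h'⟩ := Order.cofinal_meets_idealOfCofinals σ₀ 𝒟 (Sum.inl (e, b, x))
    exact ⟨τ, h', h⟩
  have h2 : ∀ e b x, ∃ τ ∈ I, τ.reflect.Good k e b x := fun e b x => by
    obtain ⟨τ, h, h'⟩ := Order.cofinal_meets_idealOfCofinals σ₀ 𝒟 (Sum.inr (e, b, x))
    exact ⟨τ, h', h⟩
  -- The values `0` and `⊥` are arbitrary: only membership of `e` in the domain is used.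
  choose τ hτ hg using fun e => h1 e 0 ⊥
  let P : V → L := fun e => (τ e).P e
  let Q : V → L := fun e => (τ e).Q e
  have hPQ : ∀ σ ∈ I, ∀ e ∈ σ.dom, P e = σ.P e ∧ Q e = σ.Q e := by
    intro σ hσ e he
    obtain ⟨υ, -, h, h'⟩ := I.directed _ (hτ e) _ hσ
    have h3 := h.2 e (hg e).1
    have h4 := h'.2 e he
    exact ⟨h3.1.symm.trans h4.1, h3.2.symm.trans h4.2⟩
  have hdir : ∀ d e, ∃ σ ∈ I, d ∈ σ.dom ∧ e ∈ σ.dom := by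
    intro d e
    obtain ⟨υ, hυ, h, h'⟩ := I.directed _ (hτ d) _ (hτ e)
    exact ⟨υ, hυ, h.1 (hg d).1, h'.1 (hg e).1⟩
  have h0 := hPQ σ₀ (Order.mem_idealOfCofinals σ₀ 𝒟) 0 (by simp [σ₀])
  refine ⟨P, Q, ⟨fun d => ?_, fun d e => ?_, fun d e => ?_, fun d e => ?_, fun e b x h => ?_,
    fun e b x h => ?_, fun e a x h => ?_, fun e a x h => ?_⟩, h0.1, h0.2⟩
  · exact (τ d).disj d (hg d).1
  · obtain ⟨σ, hσ, hd, he⟩ := hdir d e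
    rw [(hPQ σ hσ d hd).1, (hPQ σ hσ e he).1]
    exact σ.P_le d hd e he
  · obtain ⟨σ, hσ, hd, he⟩ := hdir d e
    rw [(hPQ σ hσ d hd).2, (hPQ σ hσ e he).2]
    exact σ.Q_le d hd e he
  · obtain ⟨σ, hσ, hd, he⟩ := hdir d e
    rw [(hPQ σ hσ d hd).1, (hPQ σ hσ e he).2]
    exact σ.le_sup d hd e he
  · obtain ⟨σ, hσ, he, hu, -⟩ := h1 e b x
    rw [(hPQ σ hσ e he).1] at h ⊢
    obtain ⟨c, hc, hm, h⟩ := hu h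
    exact ⟨c, hc, by rwa [(hPQ σ hσ _ hm).1]⟩
  · obtain ⟨σ, hσ, he, hu, -⟩ := h2 (-e) b x
    simp only [PartialCut.mem_reflect] at he hu
    simp only [PartialCut.reflect, neg_neg] at he hu
    rw [(hPQ σ hσ e he).2] at h ⊢
    obtain ⟨c, hc, hm, h⟩ := hu h
    rw [neg_add, neg_neg, ← sub_eq_add_neg] at hm h
    exact ⟨c, hc, by rwa [(hPQ σ hσ _ hm).2]⟩
  · obtain ⟨σ, hσ, he, -, hl⟩ := h1 e a x
    rw [(hPQ σ hσ e he).1] at h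
    obtain ⟨c, hc, hm, h⟩ := hl h
    exact ⟨c, hc, by rwa [(hPQ σ hσ _ hm).2]⟩
  · obtain ⟨σ, hσ, he, -, hl⟩ := h2 (-e) a x
    simp only [PartialCut.mem_reflect] at he hl
    simp only [PartialCut.reflect, neg_neg] at he hl
    rw [(hPQ σ hσ e he).2] at h
    obtain ⟨c, hc, hm, h⟩ := hl h
    rw [neg_add, neg_neg, ← sub_eq_add_neg] at hm h
    exact ⟨c, hc, by rwa [(hPQ σ hσ _ hm).1]⟩

end GenericCut

/-! ### Extension by one vector -/

section ExtendCut

variable {k : Type*} [DivisionRing k] [LinearOrder k] [IsStrictOrderedRing k]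
variable {L : Type*} [DistribLattice L] [OrderBot L]
variable {V : Type*} [AddCommGroup V] [Module k V]
variable {p P Q : V → L}

open Classical in
/-- The positivity map on the space spanned by `V` and a new element `y = (0, 1)`, where `P e` and
`Q e` are the truth values of `e < y` and `y < e`. -/
noncomputable def extendCut (p P Q : V → L) (x : V × k) : L :=
  if x.2 = 0 then p x.1 else if 0 < x.2 then P (-(x.2⁻¹ • x.1)) else Q (-(x.2⁻¹ • x.1))

theorem extendCut_zero (v : V) : extendCut (k := k) p P Q (v, 0) = p v := by
  simp [extendCut]

theorem extendCut_pos {t : k} (ht : 0 < t) (e : V) :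
    extendCut p P Q (t • ((-e, 1) : V × k)) = P e := by
  simp [extendCut, ht, ht.ne']

theorem extendCut_neg {t : k} (ht : 0 < t) (e : V) :
    extendCut p P Q (t • ((e, -1) : V × k)) = Q e := by
  simp [extendCut, ht.le, ht.ne']

theorem extendCut_one (e : V) : extendCut p P Q ((-e, 1) : V × k) = P e := by
  simpa using extendCut_pos (p := p) (P := P) (Q := Q) (one_pos (α := k)) e

theorem extendCut_neg_one (e : V) : extendCut p P Q ((e, -1) : V × k) = Q e := by
  simpa using extendCut_neg (p := p) (P := P) (Q := Q) (one_pos (α := k)) e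

theorem eq_smul_of_pos {x : V × k} (h : 0 < x.2) : ∃ e, x = x.2 • ((-e, 1) : V × k) :=
  ⟨-(x.2⁻¹ • x.1), Prod.ext (by simp [h.ne']) (by simp)⟩

theorem eq_smul_of_neg {x : V × k} (h : x.2 < 0) : ∃ e, x = (-x.2) • ((e, -1) : V × k) :=
  ⟨-(x.2⁻¹ • x.1), Prod.ext (by simp [h.ne]) (by simp)⟩

theorem trichotomy (x : V × k) : (∃ v, x = (v, 0)) ∨
    (∃ t : k, 0 < t ∧ ∃ e, x = t • ((-e, 1) : V × k)) ∨
    (∃ t : k, 0 < t ∧ ∃ e, x = t • ((e, -1) : V × k)) := by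
  rcases lt_trichotomy x.2 0 with h | h | h
  · exact Or.inr (Or.inr ⟨_, neg_pos.mpr h, eq_smul_of_neg h⟩)
  · exact Or.inl ⟨x.1, Prod.ext rfl h⟩
  · exact Or.inr (Or.inl ⟨_, h, eq_smul_of_pos h⟩)

/-- Passing from `y` to `-y` exchanges the two halves of the cut; this disposes of negative
coefficients in what follows. -/
theorem extendCut_reflect (v : V) (t : k) :
    extendCut p (fun e => Q (-e)) (fun e => P (-e)) (v, t) = extendCut p P Q (v, -t) := by
  rcases lt_trichotomy t 0 with h | rfl | h
  · simp [extendCut, h.ne, h, h.not_gt]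
  · simp [extendCut]
  · simp [extendCut, h.ne', h, h.not_gt]

theorem IsClosedCut.reflect (h : IsClosedCut k p P Q) :
    IsClosedCut k p (fun e => Q (-e)) (fun e => P (-e)) where
  disj d := by rw [inf_comm]; exact h.disj _
  P_le d e := by simpa only [neg_sub_neg] using h.Q_le (-d) (-e)
  Q_le d e := by simpa only [neg_sub_neg] using h.P_le (-d) (-e)
  le_sup d e := by rw [sup_comm]; simpa only [neg_sub_neg] using h.le_sup (-e) (-d)
  P_upper e b x hx := by
    obtain ⟨c, hc, h⟩ := h.Q_upper (-e) b x hx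
    exact ⟨c, hc, by rwa [neg_add, ← sub_eq_add_neg]⟩
  Q_upper e b x hx := by
    obtain ⟨c, hc, h⟩ := h.P_upper (-e) b x hx
    exact ⟨c, hc, by rwa [neg_sub', sub_neg_eq_add]⟩
  P_lower e b x hx := by
    obtain ⟨c, hc, h⟩ := h.Q_lower (-e) b x hx
    exact ⟨c, hc, by rwa [neg_add, ← sub_eq_add_neg]⟩
  Q_lower e b x hx := by
    obtain ⟨c, hc, h⟩ := h.P_lower (-e) b x hx
    exact ⟨c, hc, by rwa [neg_sub', sub_neg_eq_add]⟩

/-- After scaling, `x` is `y₀ - a` for the new vector `y₀`, and a sum with positive total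
coefficient is a multiple of some `y₀ - m`. The cut axioms compare `m` with `a` and with the second
cut point. -/
theorem extendCut_add_of_pos (hp : IsPositivity k p) (h : IsClosedCut k p P Q) {x y : V × k}
    (hx : 0 < x.2) (hxy : 0 ≤ x.2 + y.2) :
    extendCut p P Q (x + y) ≤ extendCut p P Q x ⊔ extendCut p P Q y := by
  obtain ⟨a, ha⟩ := eq_smul_of_pos hx
  set t := x.2
  have hPx : extendCut p P Q x = P a := by rw [ha, extendCut_pos hx]
  rw [hPx]
  rcases trichotomy y with ⟨v, rfl⟩ | ⟨r, hr, b, rfl⟩ | ⟨r, hr, b, rfl⟩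
  · rw [extendCut_zero, show x + (v, 0) = t • ((-(a - t⁻¹ • v), 1) : V × k) from ?_,
      extendCut_pos hx]
    · refine (h.P_le _ a).trans ?_
      rw [sub_sub_cancel, hp.smul _ _ (inv_pos.mpr hx)]
    · rw [ha]
      ext <;> simp [smul_sub, hx.ne']; abel
  · rw [extendCut_pos hr]
    have htr := add_pos hx hr
    -- A weighted mean: `a - m` and `b - m` are positive multiples of `a - b` and `b - a`, which
    -- cannot both be positive at a point.
    set m := (t + r)⁻¹ • (t • a + r • b) with hm
    have hm' : (t + r) • m = t • a + r • b := smul_inv_smul₀ htr.ne' _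
    have h1 : p (a - m) = p (a - b) := by
      rw [← hp.smul _ _ htr, smul_sub, hm', add_smul, show t • a + r • a - (t • a + r • b) =
        r • (a - b) by rw [smul_sub]; abel, hp.smul _ _ hr]
    have h2 : p (b - m) = p (b - a) := by
      rw [← hp.smul _ _ htr, smul_sub, hm', add_smul, show t • b + r • b - (t • a + r • b) =
        t • (b - a) by rw [smul_sub]; abel, hp.smul _ _ hx]
    rw [show x + r • ((-b, 1) : V × k) = (t + r) • ((-m, 1) : V × k) from ?_, extendCut_pos htr,
      LatPoint.le_iff]
    · intro s hs
      have h3 := s.mono (h.P_le m a) hs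
      have h4 := s.mono (h.P_le m b) hs
      rw [s.sup_iff] at h3 h4
      rw [h1] at h3
      rw [h2] at h4
      rw [s.sup_iff]
      have h5 : s.holds (p (a - b)) → _ := hp.asymm_sub s
      tauto
    · rw [ha]
      ext
      · simp [hm']; abel
      · simp
  · rw [extendCut_neg hr]
    have hrt : r ≤ t := by simpa using hxy
    rcases hrt.eq_or_lt with rfl | hrt
    · rw [ha, ← smul_add, show ((-a, 1) : V × k) + (b, -1) = (b - a, 0) by
        ext <;> simp; abel]
      rw [Prod.smul_mk, smul_zero, extendCut_zero, hp.smul _ _ hr]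
      exact h.le_sup a b
    · have htr := sub_pos.mpr hrt
      -- Here `m` extrapolates beyond `a`, so that `a - m` is a positive multiple of `b - a`.
      set m := (t - r)⁻¹ • (t • a - r • b) with hm
      have hm' : (t - r) • m = t • a - r • b := smul_inv_smul₀ htr.ne' _
      have h1 : p (a - m) = p (b - a) := by
        rw [← hp.smul _ _ htr, smul_sub, hm', sub_smul, show t • a - r • a - (t • a - r • b) =
          r • (b - a) by rw [smul_sub]; abel, hp.smul _ _ hr]
      rw [show x + r • ((b, -1) : V × k) = (t - r) • ((-m, 1) : V × k) from ?_, extendCut_pos htr]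
      · refine (h.P_le m a).trans ?_
        rw [h1]
        exact sup_le le_sup_left (h.le_sup a b)
      · rw [ha]
        ext
        · simp [hm']; abel
        · simp [sub_eq_add_neg]

theorem extendCut_add_of_nonneg (hp : IsPositivity k p) (h : IsClosedCut k p P Q) {x y : V × k}
    (hxy : 0 ≤ x.2 + y.2) :
    extendCut p P Q (x + y) ≤ extendCut p P Q x ⊔ extendCut p P Q y := by
  by_cases hx : 0 < x.2
  · exact extendCut_add_of_pos hp h hx hxy
  by_cases hy : 0 < y.2
  · rw [add_comm, sup_comm]
    exact extendCut_add_of_pos hp h hy (by rwa [add_comm])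
  rw [not_lt] at hx hy
  have hx0 : x.2 = 0 := le_antisymm hx (hxy.trans (add_le_of_nonpos_right hy))
  have hy0 : y.2 = 0 := le_antisymm hy (hxy.trans (add_le_of_nonpos_left hx))
  obtain ⟨v, t⟩ := x
  obtain ⟨w, r⟩ := y
  simp only at hx0 hy0
  subst hx0 hy0
  rw [Prod.mk_add_mk, add_zero, extendCut_zero, extendCut_zero, extendCut_zero]
  exact hp.add v w

theorem isPositivity_extendCut (hp : IsPositivity k p) (h : IsClosedCut k p P Q) :
    IsPositivity k (extendCut (k := k) p P Q) where
  zero := by rw [← hp.zero, ← extendCut_zero (k := k) (p := p) (P := P) (Q := Q) 0]; rfl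
  smul c x hc := by
    rcases trichotomy x with ⟨v, rfl⟩ | ⟨r, hr, b, rfl⟩ | ⟨r, hr, b, rfl⟩
    · rw [Prod.smul_mk, smul_zero, extendCut_zero, extendCut_zero, hp.smul _ _ hc]
    · rw [← mul_smul, extendCut_pos hr, extendCut_pos (mul_pos hc hr)]
    · rw [← mul_smul, extendCut_neg hr, extendCut_neg (mul_pos hc hr)]
  disj x := by
    rcases trichotomy x with ⟨v, rfl⟩ | ⟨r, hr, b, rfl⟩ | ⟨r, hr, b, rfl⟩
    · rw [Prod.neg_mk, neg_zero, extendCut_zero, extendCut_zero, hp.disj]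
    · rw [← smul_neg, Prod.neg_mk, neg_neg, extendCut_pos hr, extendCut_neg hr, h.disj]
    · rw [← smul_neg, Prod.neg_mk, neg_neg, extendCut_pos hr, extendCut_neg hr, inf_comm, h.disj]
  add x y := by
    rcases le_total 0 (x.2 + y.2) with hxy | hxy
    · exact extendCut_add_of_nonneg hp h hxy
    · have h1 := extendCut_add_of_nonneg hp h.reflect (x := (x.1, -x.2)) (y := (y.1, -y.2))
        (by simp only; rw [← neg_add]; exact neg_nonneg.mpr hxy)
      rw [Prod.mk_add_mk, extendCut_reflect, extendCut_reflect, extendCut_reflect, neg_add,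
        neg_neg, neg_neg] at h1
      exact h1

/-- According to the coefficient of the new vector in `y`, closedness against `y` comes from
`P_upper`, `P_lower` or `Q_lower`. -/
theorem closedAt_extendCut_of_pos (hp : IsPositivity k p) (h : IsClosedCut k p P Q)
    (e : V) (y : V × k) : ClosedAt k (extendCut p P Q) ((-e, 1) : V × k) y := by
  have hext := isPositivity_extendCut hp h
  rcases trichotomy y with ⟨b, rfl⟩ | ⟨r, hr, d, rfl⟩ | ⟨r, hr, d, rfl⟩
  · intro x hx
    rw [extendCut_one, extendCut_zero] at hx
    obtain ⟨c, hc, hcx⟩ := h.P_upper e b x hx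
    refine ⟨c, hc, ?_⟩
    rw [Prod.smul_mk, smul_zero, Prod.mk_sub_mk, sub_zero, ← neg_add', extendCut_one,
      extendCut_one]
    exact hcx
  · refine hext.closedAt_smul_right (fun x hx => ?_) hr
    rw [extendCut_one, extendCut_one] at hx
    -- Enlarging `x` by `Q d` is harmless: at a point of `P e` outside `x`, `hx` puts the point in
    -- `P d`.
    obtain ⟨c, hc, hcx⟩ := h.P_lower d (d - e) (x ⊔ Q d) (by
      refine (h.le_sup e d).trans ((sup_le_sup_right hx _).trans ?_)
      rw [sup_assoc])
    have hci := inv_pos.mpr hc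
    -- With this scalar the difference is `c⁻¹` times `d + c • (d - e)` minus the new vector, so its
    -- truth value is the `Q` bounded by `hcx`.
    refine ⟨1 + c⁻¹, by positivity, ?_⟩
    rw [extendCut_one, show ((-e, 1) : V × k) - (1 + c⁻¹) • ((-d, 1) : V × k) =
      c⁻¹ • ((d + c • (d - e), -1) : V × k) from ?_, extendCut_neg hci, LatPoint.le_iff]
    · intro s hs
      rw [s.inf_iff] at hs
      have h1 := s.mono (h.P_le e (d + c • (d - e))) hs.1
      have h2 := s.mono hx hs.1
      have h3 := s.mono hcx
      have hpc : 0 < 1 + c := by positivity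
      rw [show d + c • (d - e) - e = (1 + c) • (d - e) by rw [add_smul, one_smul]; abel,
        hp.smul _ _ hpc] at h1
      have h4 : ∀ f, ¬ (s.holds (P f) ∧ s.holds (Q f)) := fun f => by
        rw [← s.inf_iff, h.disj]; exact s.not_bot
      have h5 := h4 (d + c • (d - e))
      have h6 := h4 d
      simp only [s.sup_iff, s.inf_iff] at h1 h2 h3
      tauto
    · ext
      · simp [smul_add, add_smul, inv_smul_smul₀ hc.ne']; abel
      · simp
  · refine hext.closedAt_smul_right (fun x hx => ?_) hr
    rw [extendCut_one, extendCut_neg_one] at hx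
    obtain ⟨c, hc, hcx⟩ := h.Q_lower d (d - e) x (by
      refine (h.le_sup e d).trans ((sup_le_sup_right hx _).trans ?_)
      rw [sup_right_comm, sup_idem])
    have hci := inv_pos.mpr hc
    have hpc : 0 < 1 + c⁻¹ := by positivity
    set m := d - (1 + c⁻¹)⁻¹ • (d - e) with hm
    have hm' : (1 + c⁻¹) • m = e + c⁻¹ • d := by
      rw [hm, smul_sub, smul_inv_smul₀ hpc.ne', add_smul, one_smul]; abel
    -- When `d` is above `e`, this places `d - c • (d - e)` below `m`, so `P m` implies the value of
    -- `P` bounded by `hcx`.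
    have hmc : 0 < c - (1 + c⁻¹)⁻¹ := by
      rw [sub_pos]
      exact inv_lt_of_inv_lt₀ hc (lt_add_of_pos_left _ one_pos)
    refine ⟨c⁻¹, hci.le, ?_⟩
    rw [extendCut_one, show ((-e, 1) : V × k) - c⁻¹ • ((d, -1) : V × k) =
      (1 + c⁻¹) • ((-m, 1) : V × k) from ?_, extendCut_pos hpc, LatPoint.le_iff]
    · intro s hs
      rw [s.inf_iff] at hs
      have h1 := s.mono (h.P_le e d) hs.1
      have h2 := s.mono hx hs.1
      have h3 := s.mono hcx
      have h4 := s.mono (h.P_le m (d - c • (d - e))) hs.2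
      rw [show d - c • (d - e) - m = (c - (1 + c⁻¹)⁻¹) • (-(d - e)) by
        rw [hm, smul_neg, sub_smul]; abel, hp.smul _ _ hmc] at h4
      have h6 : ¬ (s.holds (P d) ∧ s.holds (Q d)) := by
        rw [← s.inf_iff, h.disj]; exact s.not_bot
      have h7 : s.holds (p (d - e)) → _ := hp.asymm s
      simp only [s.sup_iff, s.inf_iff] at h1 h2 h3 h4
      tauto
    · ext
      · simp [hm']; abel
      · simp

/-- These sign patterns are half of all; the others are their negatives and follow by reflection. -/
theorem closedAt_extendCut (hp : IsClosedPositivity k p) (h : IsClosedCut k p P Q)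
    {x y : V × k} (hxy : 0 < x.2 ∨ x.2 = 0 ∧ 0 ≤ y.2) : ClosedAt k (extendCut p P Q) x y := by
  have hext := isPositivity_extendCut hp.toIsPositivity h
  rcases hxy with hx | ⟨hx, hy⟩
  · obtain ⟨e, he⟩ := eq_smul_of_pos hx
    rw [he]
    exact hext.closedAt_smul_left (closedAt_extendCut_of_pos hp.toIsPositivity h e y) hx
  obtain ⟨a, t⟩ := x
  obtain rfl : t = 0 := hx
  rcases hy.eq_or_lt with hy | hy
  · obtain ⟨b, r⟩ := y
    obtain rfl : 0 = r := hy
    intro x hx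
    rw [extendCut_zero, extendCut_zero] at hx
    obtain ⟨c, hc, h⟩ := hp.closed a b x hx
    refine ⟨c, hc, ?_⟩
    rwa [Prod.smul_mk, smul_zero, Prod.mk_sub_mk, sub_zero, extendCut_zero, extendCut_zero]
  · obtain ⟨e, he⟩ := eq_smul_of_pos hy
    rw [he]
    refine hext.closedAt_smul_right (fun x hx => ?_) hy
    rw [extendCut_zero, extendCut_one] at hx
    obtain ⟨c, hc, hcx⟩ := h.P_lower e a x hx
    have hci := inv_pos.mpr hc
    refine ⟨c⁻¹, hci.le, ?_⟩
    rwa [extendCut_zero, show ((a, 0) : V × k) - c⁻¹ • ((-e, 1) : V × k) =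
      c⁻¹ • ((e + c • a, -1) : V × k) from ?_, extendCut_neg hci]
    ext
    · simp [inv_smul_smul₀ hc.ne']; abel
    · simp

theorem isClosedPositivity_extendCut (hp : IsClosedPositivity k p) (h : IsClosedCut k p P Q) :
    IsClosedPositivity k (extendCut (k := k) p P Q) where
  toIsPositivity := isPositivity_extendCut hp.toIsPositivity h
  closed x y := by
    by_cases hxy : 0 < x.2 ∨ x.2 = 0 ∧ 0 ≤ y.2
    · exact closedAt_extendCut hp h hxy
    · have h1 := closedAt_extendCut hp h.reflect (x := (x.1, -x.2)) (y := (y.1, -y.2)) (by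
        simp only [not_or, not_and, not_le, not_lt] at hxy
        rcases hxy.1.eq_or_lt with h0 | h0
        · exact Or.inr ⟨by simp [h0], by simpa using (hxy.2 h0).le⟩
        · exact Or.inl (by simpa using h0))
      intro z hz
      obtain ⟨c, hc, h2⟩ := h1 z (by simpa [extendCut_reflect] using hz)
      refine ⟨c, hc, ?_⟩
      rw [Prod.smul_mk, Prod.mk_sub_mk, extendCut_reflect, extendCut_reflect] at h2
      convert h2 using 2
      · simp
      · congr 1; ext <;> simp; abel

/-- A closed positivity map with values in a completely normal lattice can be extended by one new
vector that is nonnegative and has a prescribed truth value of being positive. -/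
theorem IsClosedPositivity.exists_extension [Countable V] [Countable L] (hL : CompletelyNormal L)
    (hp : IsClosedPositivity k p) (c : L) :
    ∃ q : V × k → L, IsClosedPositivity k q ∧ (∀ v, q (v, 0) = p v) ∧ q (0, 1) = c ∧
      q (0, -1) = ⊥ := by
  obtain ⟨P, Q, h, hP, hQ⟩ := exists_isClosedCut hL hp c
  refine ⟨extendCut p P Q, isClosedPositivity_extendCut hp h, extendCut_zero, ?_, ?_⟩
  · rw [← hP, ← extendCut_one (k := k) (p := p) (P := P) (Q := Q) 0, neg_zero]
  · rw [← hQ, ← extendCut_neg_one (k := k) (p := p) (P := P) (Q := Q) 0]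

end ExtendCut

/-! ### Countable iteration and surjectivity -/

section Iterate

variable {k : Type*} [DivisionRing k] [LinearOrder k] [IsStrictOrderedRing k]
variable {L : Type*} [DistribLattice L] [OrderBot L]
variable {V : Type*} [AddCommGroup V] [Module k V]

variable (k V) in
/-- Truncation of the new coordinates below `n`, together with the `n`-th new coordinate. -/
noncomputable def truncCoord (n : ℕ) : V × (ℕ →₀ k) →ₗ[k] (V × (ℕ →₀ k)) × k where
  toFun x := ((x.1, x.2.filter (· < n)), x.2 n)
  map_add' x y := by ext <;> simp [Finsupp.filter_add]
  map_smul' c x := by ext <;> simp [Finsupp.filter_smul]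

theorem truncCoord_of_support {n : ℕ} {x : V × (ℕ →₀ k)} (h : ∀ i ∈ x.2.support, i < n) :
    truncCoord k V n x = (x, 0) := by
  have h1 : x.2.filter (· < n) = x.2 := by
    rw [Finsupp.filter_eq_self_iff]
    exact fun i hi => h i (Finsupp.mem_support_iff.mpr hi)
  have h2 : x.2 n = 0 := by
    by_contra hn
    exact lt_irrefl n (h n (Finsupp.mem_support_iff.mpr hn))
  simp [truncCoord, h1, h2]

theorem truncCoord_single (n : ℕ) :
    truncCoord k V n (0, Finsupp.single n 1) = ((0, 0), 1) := by
  simp [truncCoord]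

/-- Every closed positivity map extends to a surjective one. -/
theorem IsClosedPositivity.exists_surjective [Countable k] [Countable V] [Countable L]
    (hL : CompletelyNormal L) {p : V → L} (hp : IsClosedPositivity k p) :
    ∃ q : V × (ℕ →₀ k) → L, IsClosedPositivity k q ∧ (∀ v, q (v, 0) = p v) ∧
      Function.Surjective q := by
  have : Nonempty L := ⟨⊥⟩
  obtain ⟨c, hc⟩ := exists_surjective_nat L
  choose! F hF hF0 hF1 hF2 using fun (q : V × (ℕ →₀ k) → L) (hq : IsClosedPositivity k q) (a : L) =>
    hq.exists_extension hL a
  -- All stages live on the final space: stage `n` sees only the coordinates below `n`, and the next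
  -- one gives the `n`-th basis vector the value `c n`.
  let q : ℕ → V × (ℕ →₀ k) → L := fun n => Nat.rec (fun x => p x.1)
    (fun n r => fun x => F r (c n) (truncCoord k V n x)) n
  have hq : ∀ n, IsClosedPositivity k (q n) := fun n => by
    induction n with
    | zero => exact hp.comp (LinearMap.fst k V (ℕ →₀ k))
    | succ n ih => exact (hF _ ih (c n)).comp (truncCoord k V n)
  have hstep : ∀ n x, (∀ i ∈ x.2.support, i < n) → q (n + 1) x = q n x := fun n x hx => by
    change F (q n) (c n) (truncCoord k V n x) = _
    rw [truncCoord_of_support hx, hF0 _ (hq n)]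
  have hstab : ∀ n m x, n ≤ m → (∀ i ∈ x.2.support, i < n) → q m x = q n x := by
    intro n m x hnm hx
    induction m, hnm using Nat.le_induction with
    | base => rfl
    | succ m hnm ih => rw [hstep m x fun i hi => (hx i hi).trans_le hnm, ih]
  -- From stage `N x` on, the value at `x` is constant, so each axiom for the limit is checked at
  -- one large stage.
  let N : V × (ℕ →₀ k) → ℕ := fun x => x.2.support.sup id + 1
  have hN : ∀ x, ∀ i ∈ x.2.support, i < N x := fun x i hi =>
    Nat.lt_succ_of_le (Finset.le_sup (f := id) hi)
  have hlim : ∀ m x, N x ≤ m → q (N x) x = q m x := fun m x h => (hstab _ _ x h (hN x)).symm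
  refine ⟨fun x => q (N x) x, ⟨⟨?_, fun a x ha => ?_, fun x => ?_, fun x y => ?_⟩,
    fun a b x hx => ?_⟩, fun v => ?_, fun a => ?_⟩
  · exact (hq (N 0)).zero
  · rw [hlim (max (N x) (N (a • x))) x (le_max_left _ _),
      hlim (max (N x) (N (a • x))) (a • x) (le_max_right _ _)]
    exact (hq _).smul a x ha
  · rw [hlim (max (N x) (N (-x))) x (le_max_left _ _),
      hlim (max (N x) (N (-x))) (-x) (le_max_right _ _)]
    exact (hq _).disj x
  · have h : ∀ z ∈ [x, y, x + y], N z ≤ max (max (N x) (N y)) (N (x + y)) := by simp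
    simp only [List.forall_mem_cons] at h
    rw [hlim _ x h.1, hlim _ y h.2.1, hlim _ (x + y) h.2.2.1]
    exact (hq _).add x y
  · have h := hq (max (N a) (N b))
    rw [hlim (max (N a) (N b)) a (le_max_left _ _), hlim (max (N a) (N b)) b (le_max_right _ _)]
      at hx
    obtain ⟨d, hd, hdx⟩ := h.closed a b x hx
    refine ⟨d, hd, ?_⟩
    have hmem : ∀ i ∈ (a - d • b).2.support, i < max (N a) (N b) := fun i hi => by
      by_contra hn
      rw [not_lt, max_le_iff] at hn
      have ha : a.2 i = 0 := by
        by_contra h0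
        exact (hN a i (Finsupp.mem_support_iff.mpr h0)).not_ge hn.1
      have hb : b.2 i = 0 := by
        by_contra h0
        exact (hN b i (Finsupp.mem_support_iff.mpr h0)).not_ge hn.2
      simp [ha, hb] at hi
    have h1 : N (a - d • b) ≤ max (N a) (N b) := by
      refine Nat.succ_le_of_lt ((Finset.sup_lt_iff ?_).mpr hmem)
      exact lt_max_of_lt_left (Nat.succ_pos _)
    rwa [hlim _ a (le_max_left _ (N b)), hlim _ _ h1]
  · exact hstab 0 (N (v, 0)) (v, 0) (Nat.zero_le _) (by simp)
  · obtain ⟨n, rfl⟩ := hc a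
    refine ⟨(0, Finsupp.single n 1), ?_⟩
    have hn : ∀ i ∈ (((0, Finsupp.single n 1) : V × (ℕ →₀ k))).2.support, i < n + 1 := by
      intro i hi
      have := Finsupp.support_single_subset hi
      simp at this
      omega
    have h1 : N (0, Finsupp.single n 1) ≤ n + 1 :=
      Nat.succ_le_of_lt ((Finset.sup_lt_iff (Nat.succ_pos n)).mpr hn)
    refine (hlim _ _ h1).trans ?_
    change F (q n) (c n) (truncCoord k V n _) = _
    rw [truncCoord_single]
    exact hF1 _ (hq n) _

end Iterate

/-! ### Fibers, piecewise families and supports -/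

section Sections

variable {k : Type*} [DivisionRing k] [LinearOrder k] [IsStrictOrderedRing k]
variable {L : Type*} [DistribLattice L] [OrderBot L]
variable {V : Type*} [AddCommGroup V] [Module k V]
variable {p : V → L}

/-- The vectors that are neither positive nor negative at the point `s`. -/
def IsPositivity.nullspace (hp : IsPositivity k p) (s : LatPoint L) : Submodule k V where
  carrier := {v | ¬ s.holds (p v) ∧ ¬ s.holds (p (-v))}
  zero_mem' := by
    have := hp.not_zero s
    simpa using this
  add_mem' {v w} hv hw := by
    refine ⟨fun h => ?_, fun h => ?_⟩
    · exact (hp.of_add s h).elim hv.1 hw.1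
    · rw [neg_add] at h
      exact (hp.of_add s h).elim hv.2 hw.2
  smul_mem' c v hv := by
    rcases lt_trichotomy c 0 with hc | rfl | hc
    · have h1 : c • v = (-c) • (-v) := by simp
      have h2 : -(c • v) = (-c) • v := by simp
      refine ⟨fun h => hv.2 ?_, fun h => hv.1 ?_⟩
      · rwa [h1, hp.smul_iff s (neg_pos.mpr hc)] at h
      · rwa [h2, hp.smul_iff s (neg_pos.mpr hc)] at h
    · have := hp.not_zero s
      simpa using this
    · refine ⟨fun h => hv.1 ?_, fun h => hv.2 ?_⟩
      · rwa [hp.smul_iff s hc] at h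
      · rwa [← smul_neg, hp.smul_iff s hc] at h

/-- The totally ordered vector space at the point `s`. -/
def IsPositivity.Fiber (hp : IsPositivity k p) (s : LatPoint L) : Type _ := V ⧸ hp.nullspace s

namespace IsPositivity

variable (hp : IsPositivity k p) (s : LatPoint L)

instance : AddCommGroup (hp.Fiber s) := inferInstanceAs (AddCommGroup (V ⧸ hp.nullspace s))

instance : Module k (hp.Fiber s) := inferInstanceAs (Module k (V ⧸ hp.nullspace s))

/-- The projection to the fiber at `s`. -/
def toFiber : V →ₗ[k] hp.Fiber s := (hp.nullspace s).mkQ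

theorem toFiber_surjective : Function.Surjective (hp.toFiber s) := Submodule.mkQ_surjective _

theorem toFiber_eq_zero {x : V} :
    hp.toFiber s x = 0 ↔ ¬ s.holds (p x) ∧ ¬ s.holds (p (-x)) :=
  Submodule.Quotient.mk_eq_zero _

theorem holds_of_toFiber_eq {x y : V} (h : hp.toFiber s x = hp.toFiber s y)
    (hx : s.holds (p x)) : s.holds (p y) := by
  rw [← sub_eq_zero, ← map_sub, toFiber_eq_zero] at h
  have := hp.of_add s (x := x - y) (y := y) (by simpa using hx)
  tauto

/-- The order quantifies over all representatives; `holds_of_toFiber_eq` shows that one suffices. -/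
noncomputable instance : LinearOrder (hp.Fiber s) where
  le a b := ∀ x, hp.toFiber s x = a - b → ¬ s.holds (p x)
  le_refl a x hx := by
    rw [sub_self, toFiber_eq_zero] at hx
    exact hx.1
  le_trans a b c hab hbc x hx h := by
    obtain ⟨y, hy⟩ := hp.toFiber_surjective s (a - b)
    have h1 := hp.of_add s (x := y) (y := x - y) (by simpa using h)
    have h2 := hbc (x - y) (by rw [map_sub, hx, hy]; abel)
    have h3 := hab y hy
    tauto
  le_antisymm a b hab hba := by
    obtain ⟨x, hx⟩ := hp.toFiber_surjective s (a - b)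
    rw [← sub_eq_zero, ← hx, toFiber_eq_zero]
    exact ⟨hab x hx, hba (-x) (by rw [map_neg, hx, neg_sub])⟩
  le_total a b := by
    by_contra! h
    obtain ⟨⟨x, hx, h1⟩, y, hy, h2⟩ := h
    refine hp.asymm s h1 (hp.holds_of_toFiber_eq s ?_ h2)
    rw [map_neg, hx, hy, neg_sub]
  toDecidableLE := Classical.decRel _

theorem toFiber_le_toFiber {x y : V} :
    hp.toFiber s x ≤ hp.toFiber s y ↔ ¬ s.holds (p (x - y)) := by
  refine ⟨fun h => h _ (map_sub _ _ _), fun h z hz hn => h (hp.holds_of_toFiber_eq s ?_ hn)⟩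
  rw [hz, map_sub]

theorem toFiber_nonpos {x : V} : hp.toFiber s x ≤ 0 ↔ ¬ s.holds (p x) := by
  rw [← map_zero (hp.toFiber s), toFiber_le_toFiber, sub_zero]

theorem toFiber_nonneg {x : V} : 0 ≤ hp.toFiber s x ↔ ¬ s.holds (p (-x)) := by
  rw [← map_zero (hp.toFiber s), toFiber_le_toFiber, zero_sub]

theorem toFiber_pos {x : V} : 0 < hp.toFiber s x ↔ s.holds (p x) := by
  rw [← not_le, toFiber_nonpos, not_not]

instance : IsOrderedAddMonoid (hp.Fiber s) where
  add_le_add_left a b hab c := by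
    obtain ⟨x, rfl⟩ := hp.toFiber_surjective s a
    obtain ⟨y, rfl⟩ := hp.toFiber_surjective s b
    obtain ⟨z, rfl⟩ := hp.toFiber_surjective s c
    rw [← map_add, ← map_add, toFiber_le_toFiber]
    rw [toFiber_le_toFiber] at hab
    simpa using hab

instance : PosSMulMono k (hp.Fiber s) where
  smul_le_smul_of_nonneg_left c hc a b hab := by
    obtain ⟨x, rfl⟩ := hp.toFiber_surjective s a
    obtain ⟨y, rfl⟩ := hp.toFiber_surjective s b
    rcases hc.eq_or_lt with rfl | hc
    · simp
    · rw [toFiber_le_toFiber] at hab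
      rwa [← map_smul, ← map_smul, toFiber_le_toFiber, ← smul_sub, hp.smul_iff s hc]

/-- `l` describes `a`: at each point outside of `d`, where `(v, d)` is in `l`, the value of `a` is
`v`, and these regions cover all points. -/
def Describes (l : List (V × L)) (a : ∀ s, hp.Fiber s) : Prop :=
  (∀ s, ∃ q ∈ l, ¬ LatPoint.holds s q.2) ∧
    ∀ s, ∀ q ∈ l, ¬ LatPoint.holds s q.2 → a s = hp.toFiber s q.1

variable {hp}

/-- Descriptions are finite lists over a countable set when `V` and `L` are countable, so this makes
`piecewise` countable. -/
theorem Describes.unique {l : List (V × L)} {a b : ∀ s, hp.Fiber s} (ha : hp.Describes l a)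
    (hb : hp.Describes l b) : a = b := by
  funext s
  obtain ⟨q, hq, h⟩ := ha.1 s
  rw [ha.2 s q hq h, hb.2 s q hq h]

/-- Each piece is cut by the sign of its vector. The two regions overlap where the vector is null,
and there both values are zero. -/
theorem Describes.sup_zero {l : List (V × L)} {a : ∀ s, hp.Fiber s} (ha : hp.Describes l a) :
    hp.Describes (l.map (fun q => (q.1, q.2 ⊔ p (-q.1))) ++ l.map (fun q => (0, q.2 ⊔ p q.1)))
      (a ⊔ 0) := by
  refine ⟨fun s => ?_, fun s q hq h => ?_⟩
  · obtain ⟨q, hq, h⟩ := ha.1 s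
    by_cases h' : s.holds (p q.1)
    · refine ⟨(q.1, q.2 ⊔ p (-q.1)), List.mem_append_left _ (List.mem_map.mpr ⟨q, hq, rfl⟩), ?_⟩
      have := hp.asymm s h'
      rw [s.sup_iff]
      tauto
    · refine ⟨(0, q.2 ⊔ p q.1), List.mem_append_right _ (List.mem_map.mpr ⟨q, hq, rfl⟩), ?_⟩
      rw [s.sup_iff]
      tauto
  · rw [Pi.sup_apply, Pi.zero_apply]
    rw [List.mem_append, List.mem_map, List.mem_map] at hq
    rcases hq with ⟨q, hq, rfl⟩ | ⟨q, hq, rfl⟩ <;> rw [s.sup_iff, not_or] at h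
    · rw [ha.2 s q hq h.1, sup_eq_left, toFiber_nonneg]
      exact h.2
    · rw [ha.2 s q hq h.1, map_zero, sup_eq_right, toFiber_nonpos]
      exact h.2

theorem Describes.add {l m : List (V × L)} {a b : ∀ s, hp.Fiber s} (ha : hp.Describes l a)
    (hb : hp.Describes m b) :
    hp.Describes ((l.product m).map (fun q => (q.1.1 + q.2.1, q.1.2 ⊔ q.2.2))) (a + b) := by
  refine ⟨fun s => ?_, fun s q hq h => ?_⟩
  · obtain ⟨q, hq, h⟩ := ha.1 s
    obtain ⟨r, hr, h'⟩ := hb.1 s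
    refine ⟨_, List.mem_map.mpr ⟨(q, r), List.pair_mem_product.mpr ⟨hq, hr⟩, rfl⟩, ?_⟩
    rw [s.sup_iff]
    tauto
  · rw [List.mem_map] at hq
    obtain ⟨⟨q, r⟩, hqr, rfl⟩ := hq
    rw [List.pair_mem_product] at hqr
    rw [s.sup_iff, not_or] at h
    rw [Pi.add_apply, map_add, ha.2 s q hqr.1 h.1, hb.2 s r hqr.2 h.2]

theorem Describes.smul (c : k) {l : List (V × L)} {a : ∀ s, hp.Fiber s} (ha : hp.Describes l a) :
    hp.Describes (l.map (fun q => (c • q.1, q.2))) (c • a) := by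
  refine ⟨fun s => ?_, fun s q hq h => ?_⟩
  · obtain ⟨q, hq, h⟩ := ha.1 s
    exact ⟨_, List.mem_map.mpr ⟨q, hq, rfl⟩, h⟩
  · rw [List.mem_map] at hq
    obtain ⟨q, hq, rfl⟩ := hq
    rw [Pi.smul_apply, map_smul, ha.2 s q hq h]

variable (hp)

theorem describes_const (x : V) : hp.Describes [(x, ⊥)] (fun s => hp.toFiber s x) :=
  ⟨fun s => ⟨_, List.mem_singleton_self _, s.not_bot⟩, fun s q hq _ => by
    rw [List.mem_singleton] at hq
    rw [hq]⟩

/-- The families of elements of the fibers that are given piecewise by vectors. -/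
def piecewise : Submodule k (∀ s, hp.Fiber s) where
  carrier := {a | ∃ l, hp.Describes l a}
  zero_mem' := by
    have h := hp.describes_const 0
    simp only [map_zero] at h
    exact ⟨_, h⟩
  add_mem' := by
    rintro a b ⟨l, hl⟩ ⟨m, hm⟩
    exact ⟨_, hl.add hm⟩
  smul_mem' := by
    rintro c a ⟨l, hl⟩
    exact ⟨_, hl.smul c⟩

theorem sup_mem_piecewise {a b : ∀ s, hp.Fiber s} (ha : a ∈ hp.piecewise)
    (hb : b ∈ hp.piecewise) : a ⊔ b ∈ hp.piecewise := by
  obtain ⟨l, hl⟩ := hp.piecewise.sub_mem ha hb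
  have h : a ⊔ b = (a - b) ⊔ 0 + b := by rw [sup_add, sub_add_cancel, zero_add]
  rw [h]
  exact hp.piecewise.add_mem ⟨_, hl.sup_zero⟩ hb

theorem inf_mem_piecewise {a b : ∀ s, hp.Fiber s} (ha : a ∈ hp.piecewise)
    (hb : b ∈ hp.piecewise) : a ⊓ b ∈ hp.piecewise := by
  have h : a ⊓ b = -(-a ⊔ -b) := by rw [neg_sup, neg_neg, neg_neg]
  rw [h]
  exact hp.piecewise.neg_mem
    (hp.sup_mem_piecewise (hp.piecewise.neg_mem ha) (hp.piecewise.neg_mem hb))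

noncomputable instance : Lattice hp.piecewise :=
  Subtype.lattice (fun _ _ => hp.sup_mem_piecewise) (fun _ _ => hp.inf_mem_piecewise)

instance : IsOrderedAddMonoid hp.piecewise where
  add_le_add_left _ _ hab c := fun s => add_le_add_left (hab s) (c.1 s)

instance : PosSMulMono k hp.piecewise where
  smul_le_smul_of_nonneg_left _ hc _ _ hab := fun s => smul_le_smul_of_nonneg_left (hab s) hc

theorem countable_piecewise [Countable V] [Countable L] : Countable hp.piecewise :=
  Function.Injective.countable (f := fun a : hp.piecewise => a.2.choose) fun a b h => by
    have h1 := a.2.choose_spec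
    have h2 := b.2.choose_spec
    simp only at h
    rw [h] at h1
    exact Subtype.ext (h1.unique h2)

theorem coe_abs_piecewise (a : hp.piecewise) (s : LatPoint L) : (|a|).1 s = |a.1 s| := rfl

/-- The vectors as elements of `piecewise`. -/
def toPiecewise : V →ₗ[k] hp.piecewise where
  toFun x := ⟨fun s => hp.toFiber s x, _, hp.describes_const x⟩
  map_add' x y := Subtype.ext (funext fun _ => map_add _ x y)
  map_smul' c x := Subtype.ext (funext fun _ => map_smul _ c x)

/-- Since the pieces cover all points, the family is nonzero at `s` exactly when every piece
containing `s` has a nonzero vector there. This is a finite meet of elements of `L`. -/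
theorem exists_support (a : hp.piecewise) :
    ∃ z : L, ∀ s : LatPoint L, s.holds z ↔ a.1 s ≠ 0 := by
  classical
  obtain ⟨l, hl⟩ := a.2
  -- `A` is the join of the same elements, serving as a top for the meet; the covering property
  -- makes it no restriction.
  obtain ⟨A, hA⟩ := LatPoint.exists_sup l.toFinset (fun q => q.2 ⊔ (p q.1 ⊔ p (-q.1)))
  obtain ⟨z, hz⟩ := LatPoint.exists_inf l.toFinset (fun q => q.2 ⊔ (p q.1 ⊔ p (-q.1))) A
  refine ⟨z, fun s => ?_⟩
  have key : ∀ q : V × L, s.holds (q.2 ⊔ (p q.1 ⊔ p (-q.1))) ↔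
      s.holds q.2 ∨ hp.toFiber s q.1 ≠ 0 := fun q => by
    rw [s.sup_iff, s.sup_iff, Ne, toFiber_eq_zero]; tauto
  rw [hz, hA]
  simp only [key, List.mem_toFinset]
  obtain ⟨q, hq, h⟩ := hl.1 s
  constructor
  · rintro ⟨-, h1⟩
    rw [hl.2 s q hq h]
    exact (h1 q hq).resolve_left h
  · intro ha
    have h1 : ∀ q ∈ l, s.holds q.2 ∨ hp.toFiber s q.1 ≠ 0 := fun r hr => by
      rw [or_iff_not_imp_left]
      intro h
      rwa [← hl.2 s r hr h]
    exact ⟨⟨q, hq, h1 q hq⟩, h1⟩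

/-- The element of the lattice where `a` does not vanish. -/
noncomputable def support (a : hp.piecewise) : L := (hp.exists_support a).choose

theorem holds_support (a : hp.piecewise) : s.holds (hp.support a) ↔ a.1 s ≠ 0 :=
  (hp.exists_support a).choose_spec s

theorem support_toPiecewise (x : V) : hp.support (hp.toPiecewise x) = p x ⊔ p (-x) := by
  rw [LatPoint.eq_iff]
  intro s
  rw [holds_support, s.sup_iff]
  change hp.toFiber s x ≠ 0 ↔ _
  rw [Ne, toFiber_eq_zero]
  tauto

/-- Through positive parts, every value of `p` is a support; surjectivity of `p` thus passes to
supports. -/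
theorem support_toPiecewise_sup_zero (x : V) : hp.support (hp.toPiecewise x ⊔ 0) = p x := by
  rw [LatPoint.eq_iff]
  intro s
  rw [holds_support]
  change hp.toFiber s x ⊔ 0 ≠ 0 ↔ _
  rw [Ne, sup_eq_right, toFiber_nonpos, not_not]

theorem toPiecewise_nonneg {x : V} (h : p (-x) = ⊥) : 0 ≤ hp.toPiecewise x := fun s => by
  change 0 ≤ hp.toFiber s x
  rw [toFiber_nonneg, h]
  exact s.not_bot

end IsPositivity

theorem exists_uniform_bound {k : Type*} [LinearOrder k] [Zero k] {ι : Type*}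
    {D : List ι} {f : ι → k → Prop} (hf : ∀ i c d, 0 ≤ c → c ≤ d → f i c → f i d)
    (h : ∀ i ∈ D, ∃ c, 0 ≤ c ∧ f i c) : ∃ d : k, 0 ≤ d ∧ ∀ i ∈ D, f i d := by
  induction D with
  | nil => exact ⟨0, le_rfl, by simp⟩
  | cons i D ih =>
    rw [List.forall_mem_cons] at h
    obtain ⟨d, hd, hD⟩ := ih h.2
    obtain ⟨c, hc, hi⟩ := h.1
    refine ⟨max d c, le_max_of_le_left hd, ?_⟩
    rw [List.forall_mem_cons]
    exact ⟨hf i c _ hc (le_max_right _ _) hi, fun j hj => hf j d _ hd (le_max_left _ _) (hD j hj)⟩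

/-- Closedness of `p` gives a scalar for each pair of pieces of `a` and `b`, valid outside the
regions excluded by the two pieces. Finitely many pairs share one scalar, and every point lies in
some pair. -/
theorem IsClosedPositivity.exists_bound (h : IsClosedPositivity k p)
    {a b : h.toIsPositivity.piecewise} (hb : 0 ≤ b)
    (hab : h.support a ≤ h.support b) : ∃ c : k, 0 ≤ c ∧ a ≤ c • b := by
  obtain ⟨l, hl⟩ := a.2
  obtain ⟨m, hm⟩ := b.2
  have h1 : ∀ q ∈ l.product m, ∃ c : k, 0 ≤ c ∧ p q.1.1 ⊓ p (q.1.1 - c • q.2.1) ≤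
      q.1.2 ⊔ q.2.2 := by
    rintro ⟨q, r⟩ hqr
    rw [List.pair_mem_product] at hqr
    -- Where both pieces are valid and the vector of `b` is not positive, `b` vanishes because `b ≥
    -- 0`; inclusion of supports then makes `a` vanish too.
    refine h.closed _ _ _ ?_
    rw [LatPoint.le_iff]
    intro s hs
    rw [s.sup_iff, s.sup_iff]
    by_contra! hn
    have h2 : h.toFiber s r.1 = 0 := by
      have h3 : 0 ≤ b.1 s := hb s
      rw [hm.2 s r hqr.2 hn.2.2] at h3
      exact le_antisymm ((h.toFiber_nonpos s).mpr hn.1) h3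
    have h4 : ¬ s.holds (h.support b) := by
      rw [h.holds_support, not_not, hm.2 s r hqr.2 hn.2.2, h2]
    apply h4 (s.mono hab _)
    rw [h.holds_support, hl.2 s q hqr.1 hn.2.1]
    exact ((h.toFiber_pos s).mpr hs).ne'
  obtain ⟨d, hd, hdq⟩ := exists_uniform_bound (fun q c d hc hcd hx => by
    refine le_trans ?_ hx
    rw [LatPoint.le_iff]
    intro s hs
    rw [s.inf_iff] at hs ⊢
    exact ⟨hs.1, h.closedAt_mono s hc hcd hs.1 hs.2⟩) h1
  refine ⟨d, hd, fun s => ?_⟩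
  change a.1 s ≤ d • b.1 s
  obtain ⟨q, hq, hqs⟩ := hl.1 s
  obtain ⟨r, hr, hrs⟩ := hm.1 s
  have h2 := hdq (q, r) (List.pair_mem_product.mpr ⟨hq, hr⟩)
  have hbs : 0 ≤ b.1 s := hb s
  have h0 : 0 ≤ d • b.1 s := smul_nonneg hd hbs
  by_contra hn
  rw [not_le] at hn
  have h3 := h0.trans_lt hn
  rw [hl.2 s q hq hqs, h.toFiber_pos] at h3
  rw [hl.2 s q hq hqs, hm.2 s r hr hrs, ← map_smul, ← sub_pos, ← map_sub, h.toFiber_pos] at hn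
  have h4 := s.mono h2 ((s.inf_iff _ _).mpr ⟨h3, hn⟩)
  rw [s.sup_iff] at h4
  tauto

theorem IsClosedPositivity.support_le_iff (h : IsClosedPositivity k p)
    {a b : h.toIsPositivity.piecewise} :
    h.support a ≤ h.support b ↔ ∃ c : k, 0 ≤ c ∧ |a| ≤ c • |b| := by
  have habs : ∀ a : h.toIsPositivity.piecewise, h.support |a| = h.support a := fun a => by
    rw [LatPoint.eq_iff]
    intro s
    rw [h.holds_support, h.holds_support, h.coe_abs_piecewise, Ne, abs_eq_zero]
  constructor
  · intro hab
    rw [← habs a, ← habs b] at hab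
    exact h.exists_bound (abs_nonneg b) hab
  · rintro ⟨c, hc, hab⟩
    rw [LatPoint.le_iff]
    intro s
    rw [h.holds_support, h.holds_support, not_imp_not]
    intro hb
    have h1 : |a.1 s| ≤ c • |b.1 s| := hab s
    rw [hb, abs_zero, smul_zero] at h1
    exact abs_eq_zero.mp (le_antisymm h1 (abs_nonneg _))

end Sections

/-- A vector lattice together with a linear map from `V` and an isomorphism of its lattice of
principal `ℓ`-ideals with `L`, given by a map `supp` on elements. -/
theorem IsClosedPositivity.exists_realization {k : Type u} [DivisionRing k] [LinearOrder k]
    [IsStrictOrderedRing k] [Countable k] {L : Type v} [DistribLattice L] [OrderBot L]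
    [Countable L] (hL : CompletelyNormal L) {V : Type w} [AddCommGroup V] [Module k V]
    [Countable V] {p : V → L} (hp : IsClosedPositivity k p) :
    ∃ (F : Type z₁) (_ : AddCommGroup F) (_ : Lattice F) (_ : IsOrderedAddMonoid F)
      (_ : Module k F) (_ : PosSMulMono k F) (_ : Countable F) (j : V →ₗ[k] F) (supp : F → L),
      (∀ a b, supp a ≤ supp b ↔ ∃ c : k, 0 ≤ c ∧ |a| ≤ c • |b|) ∧ Function.Surjective supp ∧
      (∀ x, supp (j x) = p x ⊔ p (-x)) ∧ ∀ x, p (-x) = ⊥ → 0 ≤ j x := by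
  obtain ⟨q, hq, hqp, hsurj⟩ := hp.exists_surjective hL
  let F₀ := hq.toIsPositivity.piecewise
  have : Countable F₀ := hq.countable_piecewise
  -- Countability allows a copy of the lattice in any universe.
  have hsmall : Small.{z₁} F₀ := Countable.toSmall F₀
  let F : Type z₁ := @Shrink.{z₁} F₀ hsmall
  let ε : F ≃ F₀ := (@equivShrink F₀ hsmall).symm
  let _ : AddCommGroup F := ε.addCommGroup
  let _ : Module k F := ε.module k
  let εl : F ≃ₗ[k] F₀ := ε.linearEquiv k
  let _ : Lattice F :=
    { PartialOrder.lift ε ε.injective with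
      sup := fun a b => ε.symm (ε a ⊔ ε b)
      inf := fun a b => ε.symm (ε a ⊓ ε b)
      le_sup_left := fun a b => show ε a ≤ ε _ by simp
      le_sup_right := fun a b => show ε b ≤ ε _ by simp
      sup_le := fun a b c h h' => show ε _ ≤ ε c by
        simpa using (⟨h, h'⟩ : ε a ≤ ε c ∧ ε b ≤ ε c)
      inf_le_left := fun a b => show ε _ ≤ ε a by simp
      inf_le_right := fun a b => show ε _ ≤ ε b by simp
      le_inf := fun a b c h h' => show ε a ≤ ε _ by
        simpa using (⟨h, h'⟩ : ε a ≤ ε b ∧ ε a ≤ ε c) }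
  have hle : ∀ a b : F, a ≤ b ↔ εl a ≤ εl b := fun _ _ => Iff.rfl
  have hsup : ∀ a b : F, εl (a ⊔ b) = εl a ⊔ εl b := fun a b => ε.apply_symm_apply _
  have habs : ∀ a : F, εl |a| = |εl a| := fun a => by
    rw [abs, hsup, map_neg]; rfl
  have hadd : ∀ a b : F, a ≤ b → ∀ c, a + c ≤ b + c := fun a b h c => by
    rw [hle, map_add, map_add]
    exact add_le_add_left ((hle a b).mp h) _
  have h1 : IsOrderedAddMonoid F := { add_le_add_left := hadd }
  have h2 : PosSMulMono k F := ⟨fun c hc a b h => by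
    rw [hle] at *
    simp only [map_smul]
    exact smul_le_smul_of_nonneg_left h hc⟩
  refine ⟨F, inferInstance, inferInstance, h1, inferInstance, h2, ε.injective.countable,
    εl.symm.toLinearMap ∘ₗ hq.toPiecewise ∘ₗ LinearMap.inl k V (ℕ →₀ k),
    fun a => hq.support (εl a), fun a b => ?_, fun c => ?_, fun x => ?_, fun x hx => ?_⟩
  · rw [hq.support_le_iff]
    simp only [hle, map_smul, habs]
  · obtain ⟨x, rfl⟩ := hsurj c
    refine ⟨εl.symm (hq.toPiecewise x ⊔ 0), ?_⟩
    simp only [LinearEquiv.apply_symm_apply]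
    exact hq.support_toPiecewise_sup_zero x
  · simp only [LinearMap.comp_apply, LinearEquiv.coe_coe, LinearEquiv.apply_symm_apply,
      LinearMap.inl_apply]
    rw [hq.support_toPiecewise, hqp, Prod.neg_mk, neg_zero, hqp]
  · rw [hle, map_zero]
    simp only [LinearMap.comp_apply, LinearEquiv.coe_coe, LinearEquiv.apply_symm_apply,
      LinearMap.inl_apply]
    refine hq.toPiecewise_nonneg ?_
    rw [Prod.neg_mk, neg_zero, hqp, hx]

/-! ### Identities in Abelian ℓ-groups -/

section LGroup

variable {G : Type*} [AddCommGroup G] [Lattice G] [IsOrderedAddMonoid G]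

theorem sub_inf_sub (z x y : G) : (z - x) ⊓ (z - y) = z - (x ⊔ y) := by
  rw [sub_eq_add_neg, sub_eq_add_neg, sub_eq_add_neg, ← add_inf, neg_sup]

theorem inf_eq_neg_sup_neg (x y : G) : x ⊓ y = -(-x ⊔ -y) := by
  rw [neg_sup, neg_neg, neg_neg]

theorem posPart_inf_posPart (a b : G) : a⁺ ⊓ b⁺ = (a ⊓ b)⁺ := by
  let _ := AddCommGroup.toDistribLattice G
  exact (sup_inf_right a b 0).symm

theorem posPart_add_le (a b : G) : (a + b)⁺ ≤ a⁺ + b⁺ :=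
  sup_le (add_le_add (le_posPart a) (le_posPart b))
    (add_nonneg (posPart_nonneg a) (posPart_nonneg b))

end LGroup

/-! ### From lattice homomorphisms to positivity maps and back -/

section PosValue

variable {R : Type*} [Ring R] [LinearOrder R] [IsStrictOrderedRing R]
variable {E : Type*} [AddCommGroup E] [Lattice E] [IsOrderedAddMonoid E] [Module R E]
  [PosSMulMono R E]

theorem Idc.mk_le_mk_iff_of_nonneg {a b : E} (ha : 0 ≤ a) (hb : 0 ≤ b) :
    Idc.mk R a ≤ Idc.mk R b ↔ ∃ c : R, 0 ≤ c ∧ a ≤ c • b := by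
  rw [Idc.mk_le_mk_iff, abs_of_nonneg ha, abs_of_nonneg hb]

theorem Idc.mk_zero : Idc.mk R (0 : E) = ⊥ := rfl

/-- The scalar `d` stands for an inverse of `c`: it is `c⁻¹` over a division ring, and `1` for a
positive integer `c`. -/
theorem Idc.mk_smul {a : E} (ha : 0 ≤ a) {c d : R} (hc : 0 ≤ c) (hd : 0 ≤ d) (hdc : 1 ≤ d * c) :
    Idc.mk R (c • a) = Idc.mk R a := by
  have hca := smul_nonneg hc ha
  refine le_antisymm ((Idc.mk_le_mk_iff_of_nonneg hca ha).mpr ⟨c, hc, le_rfl⟩)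
    ((Idc.mk_le_mk_iff_of_nonneg ha hca).mpr ⟨d, hd, ?_⟩)
  rw [← mul_smul]
  simpa using smul_le_smul_right_of_le R hdc ha

theorem smul_posPart [PosSMulInf R E] {c : R} (hc : 0 ≤ c) (a : E) : (c • a)⁺ = c • a⁺ := by
  have h : ∀ b : E, b⁺ = -(-b ⊓ 0) := fun b => by rw [neg_inf, neg_neg, neg_zero]; rfl
  rw [h, h, smul_neg, PosSMulInf.smul_inf' _ _ _ hc, smul_neg, smul_zero]

variable {F : Type*} [AddCommGroup F] [Lattice F] [IsOrderedAddMonoid F] [Module R F]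
  [PosSMulMono R F]

/-- `Id_c f` is a closed homomorphism preserving the zero. -/
theorem Idc.closedHom_map [PosSMulInf R E] [PosSMulInf R F] (f : EllHom R E F) :
    Idc.map f ⊥ = ⊥ ∧ ClosedHom (Idc.map f) := by
  constructor
  · rw [← Idc.mk_zero, Idc.map_mk, map_zero, Idc.mk_zero]
  · intro I J X h
    set a := I.gen with ha
    set b := J.gen
    set x := X.gen
    have ha0 : 0 ≤ a := I.gen_nonneg
    have hb0 : 0 ≤ b := J.gen_nonneg
    have hx0 : 0 ≤ x := X.gen_nonneg
    have hfb0 := f.map_nonneg hb0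
    have hI : Idc.mk R a = I := I.mk_gen
    have hJ : Idc.mk R b = J := J.mk_gen
    have hX : Idc.mk R x = X := X.mk_gen
    rw [← hI, ← hJ, ← hX, Idc.map_mk, Idc.map_mk, ← Idc.mk_sup hfb0 hx0,
      Idc.mk_le_mk_iff_of_nonneg (f.map_nonneg ha0) (hx0.trans le_sup_right)] at h
    obtain ⟨c, hc, h⟩ := h
    -- From f a ≤ c • (f b ⊔ x) ≤ c • f b + c • x it follows that f maps `(a - c • b)⁺` below `c •
    -- x`.
    refine ⟨Idc.mk R (a - c • b)⁺, ?_, ?_⟩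
    · rw [← hI, ← hJ, ← Idc.mk_sup hb0 (posPart_nonneg _),
        Idc.mk_le_mk_iff_of_nonneg ha0 (hb0.trans le_sup_left)]
      refine ⟨c + 1, add_nonneg hc zero_le_one, ?_⟩
      calc a = c • b + (a - c • b) := by abel
        _ ≤ c • (b ⊔ (a - c • b)⁺) + (b ⊔ (a - c • b)⁺) :=
          add_le_add (smul_le_smul_of_nonneg_left le_sup_left hc)
            ((le_posPart _).trans le_sup_right)
        _ = _ := by rw [add_smul, one_smul]
    · have h1 : f.toLinearMap (a - c • b)⁺ = (f.toLinearMap a - c • f.toLinearMap b)⁺ := by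
        have h2 : f.toLinearMap ((a - c • b) ⊔ 0) = f.toLinearMap (a - c • b) ⊔ f.toLinearMap 0 :=
          f.map_sup' _ _
        rw [map_zero, map_sub, map_smul] at h2
        exact h2
      rw [Idc.map_mk, h1, ← hX, Idc.mk_le_mk_iff_of_nonneg (posPart_nonneg _) hx0]
      refine ⟨c, hc, sup_le ?_ (smul_nonneg hc hx0)⟩
      rw [sub_le_iff_le_add, add_comm, ← smul_add]
      exact h.trans (smul_le_smul_of_nonneg_left (sup_le (le_add_of_nonneg_right hx0)
        (le_add_of_nonneg_left hfb0)) hc)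

variable [PosSMulInf R E]
variable {L : Type*} [DistribLattice L] [OrderBot L]

/-- The truth value of `0 < a` given by a lattice homomorphism `φ`. -/
noncomputable def posValue (φ : LatticeHom (Idc R E) L) (a : E) : L := φ (Idc.mk R a⁺)

section

variable {φ : LatticeHom (Idc R E) L} (hφ : φ ⊥ = ⊥)

include hφ in
theorem posValue_of_nonpos {a : E} (ha : a ≤ 0) : posValue φ a = ⊥ := by
  rw [posValue, posPart_of_nonpos ha, Idc.mk_zero, hφ]

theorem posValue_of_nonneg {a : E} (ha : 0 ≤ a) : posValue φ a = φ (Idc.mk R a) := by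
  rw [posValue, posPart_of_nonneg ha]

include hφ in
theorem posValue_inf_neg (a : E) : posValue φ a ⊓ posValue φ (-a) = ⊥ := by
  rw [posValue, posValue, ← map_inf, ← Idc.mk_inf (posPart_nonneg _) (posPart_nonneg _),
    posPart_neg, posPart_inf_negPart_eq_zero, Idc.mk_zero, hφ]

theorem posValue_add_le (a b : E) : posValue φ (a + b) ≤ posValue φ a ⊔ posValue φ b := by
  have ha := posPart_nonneg a
  have hb := posPart_nonneg b
  rw [posValue, posValue, posValue, ← map_sup, ← Idc.mk_sup ha hb]
  apply OrderHomClass.mono φ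
  rw [Idc.mk_le_mk_iff_of_nonneg (posPart_nonneg _) (ha.trans le_sup_left)]
  refine ⟨1 + 1, add_nonneg zero_le_one zero_le_one, ?_⟩
  rw [add_smul, one_smul]
  exact (posPart_add_le a b).trans (add_le_add le_sup_left le_sup_right)

theorem posValue_smul {c d : R} (hc : 0 ≤ c) (hd : 0 ≤ d) (hdc : 1 ≤ d * c) (a : E) :
    posValue φ (c • a) = posValue φ a := by
  rw [posValue, smul_posPart hc, Idc.mk_smul (posPart_nonneg a) hc hd hdc, posValue]

/-- Closedness of `φ` gives `g` with a⁺ ≤ c • b⁺ + c • g and φ⟨g⟩ ≤ x. Then a⁺ ⊓ (a - c • b)⁺ = (a -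
c • b⁺)⁺ ≤ c • g. -/
theorem posValue_closed (hcl : ClosedHom φ) {a b : E} {x : L}
    (h : posValue φ a ≤ posValue φ b ⊔ x) :
    ∃ c : R, 0 ≤ c ∧ posValue φ a ⊓ posValue φ (a - c • b) ≤ x := by
  obtain ⟨U, hU, hUx⟩ := hcl _ _ x h
  set g := U.gen
  have hg : 0 ≤ g := U.gen_nonneg
  have hgU : Idc.mk R g = U := U.mk_gen
  have hb := posPart_nonneg b
  rw [← hgU, ← Idc.mk_sup hb hg,
    Idc.mk_le_mk_iff_of_nonneg (posPart_nonneg a) (hb.trans le_sup_left)] at hU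
  obtain ⟨c, hc, hU⟩ := hU
  refine ⟨c, hc, le_trans ?_ hUx⟩
  rw [posValue, posValue, ← map_inf, ← Idc.mk_inf (posPart_nonneg _) (posPart_nonneg _), ← hgU]
  apply OrderHomClass.mono φ
  rw [Idc.mk_le_mk_iff_of_nonneg (le_inf (posPart_nonneg _) (posPart_nonneg _)) hg]
  refine ⟨c, hc, ?_⟩
  have h1 : a⁺ ≤ c • b⁺ + c • g := by
    rw [← smul_add]
    exact hU.trans (smul_le_smul_of_nonneg_left (sup_le (le_add_of_nonneg_right hg)
      (le_add_of_nonneg_left hb)) hc)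
  rw [posPart_inf_posPart]
  refine sup_le ?_ (smul_nonneg hc hg)
  have h2 : a ⊓ (a - c • b) = a - c • b⁺ := by
    rw [← smul_posPart hc, posPart_def, sub_eq_add_neg a (_ ⊔ _), neg_sup, add_inf, neg_zero,
      add_zero, inf_comm, sub_eq_add_neg]
  rw [h2, sub_le_iff_le_add']
  exact (le_posPart a).trans h1

end

/-- A linear map into `F`, together with an isomorphism of `Id_c F` with `L` given by a map `supp`
on elements, is an `ℓ`-homomorphism if it is compatible with a lattice homomorphism `φ`. -/
theorem exists_ellHom_of_supp [PosSMulInf R F] {φ : LatticeHom (Idc R E) L} (hφ : φ ⊥ = ⊥)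
    (j : E →ₗ[R] F) (supp : F → L)
    (hsupp : ∀ a b, supp a ≤ supp b ↔ ∃ c : R, 0 ≤ c ∧ |a| ≤ c • |b|)
    (hsurj : Function.Surjective supp) (hj : ∀ x, supp (j x) = posValue φ x ⊔ posValue φ (-x))
    (hj0 : ∀ x, posValue φ (-x) = ⊥ → 0 ≤ j x) :
    ∃ (f : EllHom R E F) (ι : Idc R F ≃o L), ∀ I : Idc R E, φ I = ι (Idc.map f I) := by
  have hbot := fun {x : E} => posValue_of_nonpos (R := R) (φ := φ) hφ (a := x)
  have hnn : ∀ {x : E}, 0 ≤ x → supp (j x) = φ (Idc.mk R x) := fun {x} hx => by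
    rw [hj, hbot (neg_nonpos.mpr hx), sup_bot_eq, posValue_of_nonneg hx]
  have hmono : ∀ {x : E}, 0 ≤ x → 0 ≤ j x := fun {x} hx => hj0 x (hbot (neg_nonpos.mpr hx))
  have hs0 : supp 0 = ⊥ := by
    rw [← map_zero j, hnn le_rfl, Idc.mk_zero, hφ]
  have hsmono : ∀ {a b : F}, 0 ≤ a → a ≤ b → supp a ≤ supp b := fun {a b} ha hab => by
    rw [hsupp, abs_of_nonneg ha, abs_of_nonneg (ha.trans hab)]
    exact ⟨1, zero_le_one, by rwa [one_smul]⟩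
  have hsup : ∀ x y, j (x ⊔ y) = j x ⊔ j y := fun x y => by
    -- Preserving joins reduces to preserving disjointness of these two differences. Their images
    -- meet in an element of support `⊥`, which `hsupp` forces to be zero.
    have hx : 0 ≤ x ⊔ y - x := sub_nonneg.mpr le_sup_left
    have hy : 0 ≤ x ⊔ y - y := sub_nonneg.mpr le_sup_right
    have h1 : (x ⊔ y - x) ⊓ (x ⊔ y - y) = 0 := by rw [sub_inf_sub, sub_self]
    have hm : 0 ≤ j (x ⊔ y - x) ⊓ j (x ⊔ y - y) := le_inf (hmono hx) (hmono hy)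
    have h2 : supp (j (x ⊔ y - x) ⊓ j (x ⊔ y - y)) ≤ supp 0 := by
      refine (le_inf (hsmono hm inf_le_left) (hsmono hm inf_le_right)).trans ?_
      rw [hnn hx, hnn hy, ← map_inf, ← Idc.mk_inf hx hy, h1, Idc.mk_zero, hφ]
      exact bot_le
    rw [hsupp, abs_of_nonneg hm, abs_zero] at h2
    obtain ⟨c, -, h2⟩ := h2
    rw [smul_zero] at h2
    have h3 := le_antisymm h2 hm
    rw [map_sub, map_sub, sub_inf_sub] at h3
    exact sub_eq_zero.mp h3
  let f : EllHom R E F :=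
    { j with
      map_sup' := hsup
      map_inf' := fun x y => by
        change j (x ⊓ y) = j x ⊓ j y
        rw [inf_eq_neg_sup_neg, map_neg, hsup, map_neg, map_neg, ← inf_eq_neg_sup_neg] }
  let ι₀ : Idc R F ↪o L := OrderEmbedding.ofMapLEIff (fun I => supp I.gen) (fun I J => by
    rw [hsupp, ← Idc.mk_le_mk_iff, I.mk_gen, J.mk_gen])
  have hι₀ : ∀ a : F, ι₀ (Idc.mk R a) = supp a := fun a => by
    have h := (Idc.mk R a).mk_gen
    apply le_antisymm
    · exact (hsupp _ _).mpr (Idc.mk_le_mk_iff.mp h.le)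
    · exact (hsupp _ _).mpr (Idc.mk_le_mk_iff.mp h.ge)
  have hι₀s : Function.Surjective ι₀ := fun c => by
    obtain ⟨a, rfl⟩ := hsurj c
    exact ⟨Idc.mk R a, hι₀ a⟩
  refine ⟨f, RelIso.ofSurjective ι₀ hι₀s, fun I => ?_⟩
  change φ I = ι₀ _
  conv_lhs => rw [← I.mk_gen]
  conv_rhs => rw [← I.mk_gen]
  rw [Idc.map_mk, hι₀]
  exact (hnn I.gen_nonneg).symm

end PosValue

/-! ### Passage to the divisible hull -/

section DivisibleHull

variable {G : Type*} [AddCommGroup G] {L : Type*} [DistribLattice L] [OrderBot L]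

theorem DivisibleHull.natCast_smul_mk (n : ℕ) (g : G) (s : ℕ+) :
    (n : ℚ) • DivisibleHull.mk g s = DivisibleHull.mk (n • g) s :=
  (Nat.cast_smul_eq_nsmul ℚ n _).trans (DivisibleHull.nsmul_mk n g s)

theorem DivisibleHull.exists_smul_eq_coe (x : DivisibleHull G) :
    ∃ n : ℕ, 0 < n ∧ ∃ g : G, (n : ℚ) • x = (g : DivisibleHull G) := by
  induction x with | mk g s
  refine ⟨s, s.pos, g, ?_⟩
  rw [DivisibleHull.natCast_smul_mk, DivisibleHull.coe, DivisibleHull.mk_eq_mk]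
  exact ⟨1, by simp⟩

/-- A map that is invariant under multiplication with positive integers extends to the divisible
hull. -/
theorem DivisibleHull.exists_extension {P : G → L}
    (hP : ∀ (n : ℕ) (g : G), 0 < n → P (n • g) = P g) :
    ∃ p : DivisibleHull G → L, ∀ (n : ℕ) (x : DivisibleHull G) (g : G), 0 < n →
      (n : ℚ) • x = (g : DivisibleHull G) → p x = P g := by
  choose n hn g hg using DivisibleHull.exists_smul_eq_coe (G := G)
  refine ⟨fun x => P (g x), fun m x h hm hx => ?_⟩
  have h1 : ((m • g x : G) : DivisibleHull G) = ((n x • h : G) : DivisibleHull G) := by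
    rw [DivisibleHull.coe, DivisibleHull.coe, ← DivisibleHull.natCast_smul_mk,
      ← DivisibleHull.natCast_smul_mk, ← DivisibleHull.coe, ← DivisibleHull.coe, ← hg, ← hx,
      ← mul_smul, ← mul_smul, mul_comm]
  -- Equality in the hull is equality in `G` after multiplication by some positive integer, which
  -- `P` does not see.
  rw [DivisibleHull.mk_eq_mk] at h1
  obtain ⟨u, hu⟩ := h1
  simp only [PNat.val_ofNat, one_smul] at hu
  have h2 := congrArg P hu
  rwa [hP _ _ u.pos, hP _ _ u.pos, hP _ _ hm, hP _ _ (hn x)] at h2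

theorem DivisibleHull.countable [Countable G] : Countable (DivisibleHull G) :=
  Function.Surjective.countable (f := fun q : G × ℕ+ => DivisibleHull.mk q.1 q.2) fun x => by
    induction x with | mk g s
    exact ⟨(g, s), rfl⟩

variable [Lattice G] [IsOrderedAddMonoid G]

theorem posValue_nsmul {φ : LatticeHom (Idc ℤ G) L} {n : ℕ} (hn : 0 < n) (g : G) :
    posValue φ (n • g) = posValue φ g := by
  rw [← natCast_zsmul]
  exact posValue_smul (d := 1) (by positivity) zero_le_one (by simp; omega) g

/-- Finitely many elements of the hull have a common positive multiple in `G`, and `p` is invariant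
under positive multiples, so each axiom is checked in `G`. -/
theorem exists_isClosedPositivity_divisibleHull {φ : LatticeHom (Idc ℤ G) L} (hφ : φ ⊥ = ⊥)
    (hcl : ClosedHom φ) : ∃ p : DivisibleHull G → L, IsClosedPositivity ℚ p ∧
      ∀ g : G, p (g : DivisibleHull G) = posValue φ g := by
  obtain ⟨p, hp⟩ := DivisibleHull.exists_extension (P := posValue φ)
    (fun n g hn => posValue_nsmul hn g)
  have hcoe : ∀ g : G, p (g : DivisibleHull G) = posValue φ g := fun g =>
    hp 1 _ g one_pos (one_smul _ _)
  have hnat : ∀ (n : ℕ) (g : G), (n : ℚ) • (g : DivisibleHull G) = ((n • g : G) :) := fun n g =>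
    DivisibleHull.natCast_smul_mk n g 1
  have hsmul : ∀ (n : ℕ) (x : DivisibleHull G), 0 < n → p ((n : ℚ) • x) = p x := fun n x hn => by
    obtain ⟨m, hm, g, hg⟩ := DivisibleHull.exists_smul_eq_coe x
    rw [hp m x g hm hg, hp m ((n : ℚ) • x) (n • g) hm (by
      rw [← mul_smul, mul_comm, mul_smul, hg, hnat]), posValue_nsmul hn]
  -- any two elements have a common denominator
  have hpair : ∀ x y : DivisibleHull G, ∃ n : ℕ, 0 < n ∧ ∃ g h : G,
      (n : ℚ) • x = (g : DivisibleHull G) ∧ (n : ℚ) • y = (h : DivisibleHull G) := fun x y => by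
    obtain ⟨m, hm, g, hg⟩ := DivisibleHull.exists_smul_eq_coe x
    obtain ⟨n, hn, h, hh⟩ := DivisibleHull.exists_smul_eq_coe y
    refine ⟨m * n, Nat.mul_pos hm hn, n • g, m • h, ?_, ?_⟩
    · rw [Nat.cast_mul, mul_comm, mul_smul, hg, hnat]
    · rw [Nat.cast_mul, mul_smul, hh, hnat]
  have hneg : ∀ g : G, ((-g : G) : DivisibleHull G) = -(g : DivisibleHull G) := fun g =>
    (DivisibleHull.neg_mk g 1).symm
  refine ⟨p, ⟨⟨?_, fun c x hc => ?_, fun x => ?_, fun x y => ?_⟩, fun x y z hxy => ?_⟩, hcoe⟩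
  · rw [hp 1 0 0 one_pos (by simp), posValue_of_nonpos hφ le_rfl]
  · have h1 : (c.den : ℚ) • c • x = (c.num.toNat : ℚ) • x := by
      rw [← mul_smul, mul_comm, Rat.mul_den_eq_num]
      congr 1
      have h2 : ((c.num.toNat : ℤ) : ℚ) = c.num := by
        rw [Int.toNat_of_nonneg (Rat.num_pos.mpr hc).le]
      exact_mod_cast h2.symm
    rw [← hsmul c.den (c • x) c.den_pos, h1, hsmul]
    have := Rat.num_pos.mpr hc
    omega
  · obtain ⟨m, hm, g, hg⟩ := DivisibleHull.exists_smul_eq_coe x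
    rw [hp m x g hm hg, hp m (-x) (-g) hm (by rw [smul_neg, hg, hneg]), posValue_inf_neg hφ]
  · obtain ⟨n, hn, g, h, hg, hh⟩ := hpair x y
    rw [hp n x g hn hg, hp n y h hn hh, hp n (x + y) (g + h) hn (by
      rw [smul_add, hg, hh, DivisibleHull.coe_add])]
    exact posValue_add_le g h
  · obtain ⟨n, hn, g, h, hg, hh⟩ := hpair x y
    rw [hp n x g hn hg, hp n y h hn hh] at hxy
    obtain ⟨c, hc, h1⟩ := posValue_closed hcl hxy
    lift c to ℕ using hc
    refine ⟨c, by positivity, ?_⟩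
    rw [hp n x g hn hg, hp n (x - (c : ℚ) • y) (g - (c : ℤ) • h) hn ?_]
    · exact h1
    · rw [smul_sub, hg, ← mul_smul, mul_comm, mul_smul, hh, natCast_zsmul, sub_eq_add_neg,
        sub_eq_add_neg, DivisibleHull.coe_add, hneg, hnat]

end DivisibleHull

/-! ### Factorization of closed homomorphisms -/

section Factorization

variable {L : Type v} [DistribLattice L] [OrderBot L] [Countable L]

theorem exists_vectorLattice_factorization {k : Type u} [DivisionRing k] [LinearOrder k]
    [IsStrictOrderedRing k] [Countable k] (hL : CompletelyNormal L)
    (E : Type w) [AddCommGroup E] [Lattice E] [IsOrderedAddMonoid E] [Module k E]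
    [PosSMulMono k E] [Countable E] (φ : LatticeHom (Idc k E) L) (hφ : φ ⊥ = ⊥)
    (hcl : ClosedHom φ) :
    ∃ (F : Type z₁) (_ : AddCommGroup F) (_ : Lattice F) (_ : IsOrderedAddMonoid F)
      (_ : Module k F) (_ : PosSMulMono k F) (_ : Countable F)
      (f : EllHom k E F) (ι : Idc k F ≃o L), ∀ I : Idc k E, φ I = ι (Idc.map f I) := by
  have hp : IsClosedPositivity k (posValue φ) :=
    { zero := posValue_of_nonpos hφ le_rfl
      smul := fun c x hc => posValue_smul hc.le (inv_nonneg.mpr hc.le)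
        (inv_mul_cancel₀ hc.ne').ge x
      disj := posValue_inf_neg hφ
      add := posValue_add_le
      closed := fun a b x hx => posValue_closed hcl hx }
  obtain ⟨F, i₁, i₂, i₃, i₄, i₅, i₆, j, supp, h1, h2, h3, h4⟩ := hp.exists_realization hL
  obtain ⟨f, ι, h⟩ := exists_ellHom_of_supp hφ j supp h1 h2 h3 h4
  exact ⟨F, i₁, i₂, i₃, i₄, i₅, i₆, f, ι, h⟩

/-- The ℚ-vector lattice built over the divisible hull serves as the ℓ-group: rational scalars are
bounded by natural numbers, so its principal ℓ-ideals over ℚ and over ℤ coincide. -/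
theorem exists_ellGroup_factorization (hL : CompletelyNormal L)
    (G : Type w) [AddCommGroup G] [Lattice G] [IsOrderedAddMonoid G] [Countable G]
    (φ : LatticeHom (Idc ℤ G) L) (hφ : φ ⊥ = ⊥) (hcl : ClosedHom φ) :
    ∃ (H : Type z₁) (_ : AddCommGroup H) (_ : Lattice H) (_ : IsOrderedAddMonoid H)
      (_ : Countable H)
      (f : EllHom ℤ G H) (ι : Idc ℤ H ≃o L), ∀ I : Idc ℤ G, φ I = ι (Idc.map f I) := by
  obtain ⟨p, hp, hpG⟩ := exists_isClosedPositivity_divisibleHull hφ hcl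
  have := DivisibleHull.countable (G := G)
  obtain ⟨H, i₁, i₂, i₃, i₄, i₅, i₆, j, supp, h1, h2, h3, h4⟩ := hp.exists_realization hL
  have hneg : ∀ g : G, ((-g : G) : DivisibleHull G) = -(g : DivisibleHull G) := fun g =>
    (DivisibleHull.neg_mk g 1).symm
  let j' : G →ₗ[ℤ] H := (j.toAddMonoidHom.comp (DivisibleHull.coeAddMonoidHom G)).toIntLinearMap
  have hj' : ∀ g : G, j' g = j (g : DivisibleHull G) := fun _ => rfl
  obtain ⟨f, ι, h⟩ := exists_ellHom_of_supp hφ j' supp (fun a b => by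
    rw [h1]
    constructor
    · rintro ⟨c, -, h⟩
      obtain ⟨n, hn⟩ := exists_nat_ge c
      refine ⟨n, by positivity, h.trans ?_⟩
      rw [natCast_zsmul, ← Nat.cast_smul_eq_nsmul ℚ]
      exact smul_le_smul_right_of_le ℚ hn (abs_nonneg b)
    · rintro ⟨c, hc, h⟩
      lift c to ℕ using hc
      refine ⟨c, by positivity, ?_⟩
      rwa [Nat.cast_smul_eq_nsmul, ← natCast_zsmul]) h2 (fun x => by
    rw [hj', h3, hpG, ← hneg, hpG]) (fun x hx => by
    rw [hj']
    apply h4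
    rw [← hneg, hpG, hx])
  exact ⟨H, i₁, i₂, i₃, i₆, f, ι, h⟩

end Factorization

/-! ### Lifting lattice homomorphisms -/

section Lifting

variable {K : Type*} [DistribLattice K] [OrderBot K] {L : Type*} [DistribLattice L] [OrderBot L]

theorem ClosedHom.comp_orderIso {M : Type*} [Lattice M] [OrderBot M] (α : M ≃o K)
    {φ : LatticeHom K L} (hφ : φ ⊥ = ⊥) (hcl : ClosedHom φ) :
    ∃ ψ : LatticeHom M L, (∀ x, ψ x = φ (α x)) ∧ ψ ⊥ = ⊥ ∧ ClosedHom ψ := by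
  refine ⟨⟨⟨fun x => φ (α x), fun a b => by rw [map_sup α, map_sup]⟩,
    fun a b => by simp⟩, fun _ => rfl, ?_, fun a b x hx => ?_⟩
  · change φ (α ⊥) = ⊥
    rw [map_bot, hφ]
  · obtain ⟨u, hu, hux⟩ := hcl (α a) (α b) x hx
    refine ⟨α.symm u, ?_, ?_⟩
    · rw [← α.le_iff_le, map_sup, OrderIso.apply_symm_apply]
      exact hu
    · change φ (α (α.symm u)) ≤ x
      rwa [OrderIso.apply_symm_apply]

theorem Lifts.closedHom {R : Type*} [Ring R] [LinearOrder R] [IsStrictOrderedRing R]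
    {E : Type*} [AddCommGroup E] [Lattice E] [IsOrderedAddMonoid E] [Module R E]
    [PosSMulMono R E] [PosSMulInf R E]
    {F : Type*} [AddCommGroup F] [Lattice F] [IsOrderedAddMonoid F] [Module R F]
    [PosSMulMono R F] [PosSMulInf R F] {f : EllHom R E F} {φ : LatticeHom K L}
    (h : Lifts f φ) : ClosedHom φ := by
  obtain ⟨α, β, h⟩ := h
  intro a b x hx
  have h' : ∀ c, φ c = β (Idc.map f (α.symm c)) := fun c => by
    rw [← h, OrderIso.apply_symm_apply]
  obtain ⟨u, hu, hux⟩ := (Idc.closedHom_map f).2 (α.symm a) (α.symm b) (β.symm x) (by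
    rw [← β.le_iff_le, map_sup, OrderIso.apply_symm_apply, ← h', ← h']
    exact hx)
  refine ⟨α u, ?_, ?_⟩
  · rw [← α.symm.le_iff_le, map_sup, OrderIso.symm_apply_apply]
    exact hu
  · rw [h]
    rw [← β.symm.le_iff_le, OrderIso.symm_apply_apply]
    exact hux

/-- The homomorphism from the lattice of principal ideals of the zero module. -/
theorem exists_closedHom_of_subsingleton (R : Type*) [Ring R] [LinearOrder R]
    [IsStrictOrderedRing R]
    (E : Type*) [AddCommGroup E] [Lattice E] [IsOrderedAddMonoid E] [Module R E]
    [PosSMulMono R E] [PosSMulInf R E] [Subsingleton E] :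
    ∃ φ : LatticeHom (Idc R E) K, φ ⊥ = ⊥ ∧ ClosedHom φ := by
  refine ⟨⟨⟨fun _ => ⊥, fun _ _ => by simp⟩, fun _ _ => by simp⟩, rfl, fun a b x _ =>
    ⟨⊥, ?_, bot_le⟩⟩
  rw [← a.mk_gen, Subsingleton.elim a.gen 0]
  exact bot_le

end Lifting

/-- Factoring the zero map from the zero space realizes `K` as some Id_c E; transporting `φ` along
this isomorphism and factoring again gives the lift. -/
theorem exists_vectorLattice_lift {k : Type u} [DivisionRing k] [LinearOrder k]
    [IsStrictOrderedRing k] [Countable k] {L : Type v} [DistribLattice L] [OrderBot L]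
    [Countable L] (hL : CompletelyNormal L) {K : Type z₃} [DistribLattice K] [OrderBot K]
    [Countable K] (hK : CompletelyNormal K) (φ : LatticeHom K L) (hφ : φ ⊥ = ⊥)
    (hcl : ClosedHom φ) :
    ∃ (E : Type z₁) (_ : AddCommGroup E) (_ : Lattice E) (_ : IsOrderedAddMonoid E)
      (_ : Module k E) (_ : PosSMulMono k E)
      (F : Type z₂) (_ : AddCommGroup F) (_ : Lattice F) (_ : IsOrderedAddMonoid F)
      (_ : Module k F) (_ : PosSMulMono k F) (f : EllHom k E F),
      Countable E ∧ Countable F ∧ Lifts f φ := by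
  have : PosSMulMono k PUnit.{1} := ⟨fun _ _ _ _ _ => le_rfl⟩
  obtain ⟨φ₀, h₀, hcl₀⟩ := exists_closedHom_of_subsingleton (K := K) k PUnit.{1}
  obtain ⟨E, _, _, _, _, _, _, -, α, -⟩ :=
    exists_vectorLattice_factorization.{u, z₃, 0, z₁} hK PUnit.{1} φ₀ h₀ hcl₀
  obtain ⟨ψ, hψ, hψ0, hψcl⟩ := hcl.comp_orderIso α hφ
  obtain ⟨F, _, _, _, _, _, _, f, β, h⟩ :=
    exists_vectorLattice_factorization.{u, v, z₁, z₂} hL E ψ hψ0 hψcl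
  exact ⟨E, _, _, ‹_›, _, ‹_›, F, _, _, ‹_›, _, ‹_›, f, ‹_›, ‹_›, α, β, fun I => by rw [← hψ, h]⟩

theorem exists_ellGroup_lift {L : Type v} [DistribLattice L] [OrderBot L]
    [Countable L] (hL : CompletelyNormal L) {K : Type z₃} [DistribLattice K] [OrderBot K]
    [Countable K] (hK : CompletelyNormal K) (φ : LatticeHom K L) (hφ : φ ⊥ = ⊥)
    (hcl : ClosedHom φ) :
    ∃ (G : Type z₁) (_ : AddCommGroup G) (_ : Lattice G) (_ : IsOrderedAddMonoid G)
      (H : Type z₂) (_ : AddCommGroup H) (_ : Lattice H) (_ : IsOrderedAddMonoid H)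
      (f : EllHom ℤ G H), Countable G ∧ Countable H ∧ Lifts f φ := by
  obtain ⟨φ₀, h₀, hcl₀⟩ := exists_closedHom_of_subsingleton (K := K) ℤ PUnit.{1}
  obtain ⟨E, _, _, _, _, -, α, -⟩ :=
    exists_ellGroup_factorization.{z₃, 0, z₁} hK PUnit.{1} φ₀ h₀ hcl₀
  obtain ⟨ψ, hψ, hψ0, hψcl⟩ := hcl.comp_orderIso α hφ
  obtain ⟨F, _, _, _, _, f, β, h⟩ :=
    exists_ellGroup_factorization.{v, z₁, z₂} hL E ψ hψ0 hψcl
  exact ⟨E, _, _, ‹_›, F, _, _, ‹_›, f, ‹_›, ‹_›, α, β, fun I => by rw [← hψ, h]⟩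

theorem theorem8p3
    (k : Type u) [DivisionRing k] [LinearOrder k] [IsStrictOrderedRing k] [Countable k]
    (L : Type v) [DistribLattice L] [OrderBot L] [Countable L] (hL : CompletelyNormal L) :
    -- factorization, for vector lattices over `k`
    (∀ (E : Type w) [AddCommGroup E] [Lattice E] [IsOrderedAddMonoid E] [Module k E]
        [PosSMulMono k E] [Countable E] (φ : LatticeHom (Idc k E) L),
      φ ⊥ = ⊥ → ClosedHom φ →
      ∃ (F : Type z₁) (_ : AddCommGroup F) (_ : Lattice F) (_ : IsOrderedAddMonoid F)
        (_ : Module k F) (_ : PosSMulMono k F) (_ : Countable F)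
        (f : EllHom k E F) (ι : Idc k F ≃o L), ∀ I : Idc k E, φ I = ι (Idc.map f I)) ∧
    -- factorization, for Abelian `ℓ`-groups
    (∀ (G : Type w) [AddCommGroup G] [Lattice G] [IsOrderedAddMonoid G] [Countable G]
        (φ : LatticeHom (Idc ℤ G) L),
      φ ⊥ = ⊥ → ClosedHom φ →
      ∃ (H : Type z₁) (_ : AddCommGroup H) (_ : Lattice H) (_ : IsOrderedAddMonoid H)
        (_ : Countable H)
        (f : EllHom ℤ G H) (ι : Idc ℤ H ≃o L), ∀ I : Idc ℤ G, φ I = ι (Idc.map f I)) ∧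
    -- `Id_c f` is always a closed homomorphism preserving the zero
    (∀ (E : Type z₁) [AddCommGroup E] [Lattice E] [IsOrderedAddMonoid E] [Module k E]
        [PosSMulMono k E]
        (F : Type z₂) [AddCommGroup F] [Lattice F] [IsOrderedAddMonoid F] [Module k F]
        [PosSMulMono k F] (f : EllHom k E F), Idc.map f ⊥ = ⊥ ∧ ClosedHom (Idc.map f)) ∧
    (∀ (G : Type z₁) [AddCommGroup G] [Lattice G] [IsOrderedAddMonoid G]
        (H : Type z₂) [AddCommGroup H] [Lattice H] [IsOrderedAddMonoid H] (f : EllHom ℤ G H),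
        Idc.map f ⊥ = ⊥ ∧ ClosedHom (Idc.map f)) ∧
    -- liftable if and only if closed
    (∀ (K : Type z₃) [DistribLattice K] [OrderBot K] [Countable K], CompletelyNormal K →
      ∀ φ : LatticeHom K L, φ ⊥ = ⊥ →
      -- by vector lattices over `k`
      List.TFAE [
        ClosedHom φ,
        ∃ (E : Type z₁) (_ : AddCommGroup E) (_ : Lattice E) (_ : IsOrderedAddMonoid E)
          (_ : Module k E) (_ : PosSMulMono k E)
          (F : Type z₂) (_ : AddCommGroup F) (_ : Lattice F) (_ : IsOrderedAddMonoid F)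
          (_ : Module k F) (_ : PosSMulMono k F) (f : EllHom k E F),
          Lifts f φ,
        ∃ (E : Type z₁) (_ : AddCommGroup E) (_ : Lattice E) (_ : IsOrderedAddMonoid E)
          (_ : Module k E) (_ : PosSMulMono k E)
          (F : Type z₂) (_ : AddCommGroup F) (_ : Lattice F) (_ : IsOrderedAddMonoid F)
          (_ : Module k F) (_ : PosSMulMono k F) (f : EllHom k E F),
          Countable E ∧ Countable F ∧ Lifts f φ] ∧
      -- by Abelian `ℓ`-groups
      List.TFAE [
        ClosedHom φ,
        ∃ (G : Type z₁) (_ : AddCommGroup G) (_ : Lattice G) (_ : IsOrderedAddMonoid G)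
          (H : Type z₂) (_ : AddCommGroup H) (_ : Lattice H) (_ : IsOrderedAddMonoid H)
          (f : EllHom ℤ G H),
          Lifts f φ,
        ∃ (G : Type z₁) (_ : AddCommGroup G) (_ : Lattice G) (_ : IsOrderedAddMonoid G)
          (H : Type z₂) (_ : AddCommGroup H) (_ : Lattice H) (_ : IsOrderedAddMonoid H)
          (f : EllHom ℤ G H),
          Countable G ∧ Countable H ∧ Lifts f φ]) := by
  refine ⟨fun E _ _ _ _ _ _ φ hφ hcl => exists_vectorLattice_factorization hL E φ hφ hcl,
    fun G _ _ _ _ φ hφ hcl => exists_ellGroup_factorization hL G φ hφ hcl,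
    fun E _ _ _ _ _ F _ _ _ _ _ f => Idc.closedHom_map f,
    fun G _ _ _ H _ _ _ f => Idc.closedHom_map f,
    fun K _ _ _ hK φ hφ => ⟨?_, ?_⟩⟩
  · tfae_have 1 → 3 := fun hcl => exists_vectorLattice_lift hL hK φ hφ hcl
    tfae_have 3 → 2 := by
      rintro ⟨E, i₁, i₂, i₃, i₄, i₅, F, j₁, j₂, j₃, j₄, j₅, f, -, -, h⟩
      exact ⟨E, i₁, i₂, i₃, i₄, i₅, F, j₁, j₂, j₃, j₄, j₅, f, h⟩
    tfae_have 2 → 1 := by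
      rintro ⟨E, i₁, i₂, i₃, i₄, i₅, F, j₁, j₂, j₃, j₄, j₅, f, h⟩
      exact h.closedHom
    tfae_finish
  · tfae_have 1 → 3 := fun hcl => exists_ellGroup_lift hL hK φ hφ hcl
    tfae_have 3 → 2 := by
      rintro ⟨G, i₁, i₂, i₃, H, j₁, j₂, j₃, f, -, -, h⟩
      exact ⟨G, i₁, i₂, i₃, H, j₁, j₂, j₃, f, h⟩
    tfae_have 2 → 1 := by
      rintro ⟨G, i₁, i₂, i₃, H, j₁, j₂, j₃, f, h⟩
      exact h.closedHom
    tfae_finish
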